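/- For a rational function $f\in\mathbb{C}(x)$ with $f\notin\mathbb C$, viewed as a morphism $f:\mathbb{P}^1\to\mathbb{P}^1$, let $\deg(f)$ be its degree (the maximum of the degrees of numerator and denominator in lowest terms). Operators in $\mathbb{C}(x)[\partial]$, $\partial=\frac{d}{dx}$, are considered up to multiplication from the left by a nonzero element of $\mathbb{C}(x)$. A *change of variables* $L_1\xrightarrow{f}_C L_2$ is the substitution $(x,\partial)\mapsto(f,\frac{1}{f'}\partial)$ in $L_1$, and an *exp-product* $L_1\xrightarrow{r}_E L_2$ with $r\in\mathbb{C}(x)$ is the substitution $\partial\mapsto\partial-r$ in $L_1$. Let $L=A_2\partial^2+A_1\partial+A_0$ with $A_2\neq0$. A point $p\in\mathbb{C}$ is a regular point or a regular singularity of $L$ if $(x-p)A_1/A_2$ and $(x-p)^2A_0/A_2$ have no pole at $p$. In that case the exponents of $L$ at $p$ are the two roots $e_1,e_2$ of the indicial polynomial $\rho(\rho-1)+\big((x-p)\tfrac{A_1}{A_2}\big)(p)\,\rho+\big((x-p)^2\tfrac{A_0}{A_2}\big)(p)$, and $\Delta(L,p):=|e_1-e_2|$. At $p=\infty$ the same notions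 are defined by applying them at $0$ to the operator obtained from $L$ by the change of variables $x\mapsto 1/x$. $L$ is *regular singular* if every point of $\mathbb{P}^1$ is a regular point or a regular singularity of $L$. (1) Let $a_1,a_2,b_1\in\mathbb{C}$, let $L_B=x(1-x)\partial^2+(b_1-(a_1+a_2+1)x)\partial-a_1a_2$ be the Gauss hypergeometric differential operator, and let $\alpha_i=\Delta(L_B,i)$ for $i\in\{0,1,\infty\}$. Then $\alpha_0=|1-b_1|$, $\alpha_1=|b_1-a_1-a_2|$ and $\alpha_\infty=|a_1-a_2|$. If $f,r\in\mathbb{C}(x)$ with $f$ non-constant, $L_B\xrightarrow{f}_C M\xrightarrow{r}_E L_{inp}$, and $L_{inp}$ is regular singular, then $\Delta(L_{inp},p)=1$ for all but finitely many $p\in\mathbb{P}^1$, and $$-2+\sum_{p\in\mathbb{P}^1}\big(1-\Delta(L_{inp},p)\big)=\deg(f)\Big(-2+\sum_{i\in\{0,1,\infty\}}(1-\alpha_i)\Big).$$ (2) Exp-products do not change exponent differences: if $L_1\in\mathbb{C}(x)[\partial]$ has order $2$, $L_1\xrightarrow{r}_E L_2$ with $r\in\mathbb{C}(x)$, and $p\in\mathbb{P}^1$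 is a regular point or a regular singularity of both $L_1$ and $L_2$, then $\Delta(L_2,p)=\Delta(L_1,p)$. -/

import Mathlib

noncomputable section

/-- The derivation `d/dx` on the field `ℂ(x)` of rational functions (quotient rule). -/
def ratDeriv (g : RatFunc ℂ) : RatFunc ℂ :=
  algebraMap (Polynomial ℂ) (RatFunc ℂ)
      (Polynomial.derivative g.num * g.denom - g.num * Polynomial.derivative g.denom) /
    algebraMap (Polynomial ℂ) (RatFunc ℂ) (g.denom ^ 2)

/-- The composition `g ∘ f`, that is `g(f)`, of rational functions (for non-constant `f`). -/
def ratComp (g f : RatFunc ℂ) : RatFunc ℂ := RatFunc.eval RatFunc.C f g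

/-- The degree of a rational function, as a morphism from the projective line to itself. -/
def ratDegree (f : RatFunc ℂ) : ℕ := max f.num.natDegree f.denom.natDegree

/-- Linear differential operators `∑ i, A i * ∂ ^ i` with rational function coefficients, written
with the coefficients on the left. Such an operator is stored as the polynomial with the
coefficients `A i`, so the order is `natDegree` and `Polynomial.C u * L` is the left multiple of
`L` by the function `u`. The commutative product of two polynomials is not the product of
operators and is used for left multiplication by functions only. -/
abbrev DiffOp : Type := Polynomial (RatFunc ℂ)

namespace DiffOp

/-- The product of operators `(g ∂ + h) L`, by the rule `∂ a = a ∂ + a'` for functions `a`. -/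
def lmul (g h : RatFunc ℂ) (L : DiffOp) : DiffOp :=
  ∑ i ∈ Finset.range (L.natDegree + 1),
    (Polynomial.monomial (i + 1) (g * L.coeff i) +
      Polynomial.monomial i (g * ratDeriv (L.coeff i) + h * L.coeff i))

/-- The operator `∑ i, φ (A i) * (g ∂ + h) ^ i` obtained from `∑ i, A i * ∂ ^ i`: the coefficients
are transformed by `φ` and `∂` is replaced by the first order operator `g ∂ + h`. -/
def substitute (φ : RatFunc ℂ → RatFunc ℂ) (g h : RatFunc ℂ) (L : DiffOp) : DiffOp :=
  ∑ i ∈ Finset.range (L.natDegree + 1),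
    Polynomial.C (φ (L.coeff i)) * (lmul g h)^[i] 1

/-- The substitution `(x, ∂) ↦ (f, (1 / f') ∂)`. -/
def changeVar (f : RatFunc ℂ) (L : DiffOp) : DiffOp :=
  substitute (fun a => ratComp a f) (1 / ratDeriv f) 0 L

/-- The substitution `∂ ↦ ∂ - r`. -/
def expProd (r : RatFunc ℂ) (L : DiffOp) : DiffOp :=
  substitute id 1 (-r) L

/-- `L₂` is obtained from `L₁` by the change of variables `y(x) ↦ y(f)`. As this prescribes the
solutions of `L₂`, the operator `L₂` is determined up to a nonzero left factor in `ℂ(x)`. -/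
def ChangeOfVariables (f : RatFunc ℂ) (L₁ L₂ : DiffOp) : Prop :=
  ∃ u : RatFunc ℂ, u ≠ 0 ∧ L₂ = Polynomial.C u * changeVar f L₁

/-- `L₂` is obtained from `L₁` by the exp-product `y ↦ exp (∫ r dx) y`, again up to a nonzero left
factor in `ℂ(x)`. -/
def ExpProduct (r : RatFunc ℂ) (L₁ L₂ : DiffOp) : Prop :=
  ∃ u : RatFunc ℂ, u ≠ 0 ∧ L₂ = Polynomial.C u * expProd r L₁

/-- For `L = ∑ i, A i * ∂ ^ i` of order `n`, the function `(x - p) ^ (n - i) * A i / A n`. -/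
def localCoeff (L : DiffOp) (p : ℂ) (i : ℕ) : RatFunc ℂ :=
  (RatFunc.X - RatFunc.C p) ^ (L.natDegree - i) * (L.coeff i / L.leadingCoeff)

/-- The finite point `p` is a regular point or a regular singularity of `L`:
`(x - p) ^ (n - i) * A i / A n` has no pole at `p` for every `i < n`. -/
def RegularSingularAtFinite (L : DiffOp) (p : ℂ) : Prop :=
  ∀ i < L.natDegree, (localCoeff L p i).denom.eval p ≠ 0

/-- The operator obtained by the change of variables `x ↦ 1 / x`, which moves `∞` to `0`. -/
def atInfty (L : DiffOp) : DiffOp := changeVar (1 / RatFunc.X) L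

/-- The point `p` of the projective line is a regular point or a regular singularity of `L`. -/
def RegularSingularAt (L : DiffOp) : OnePoint ℂ → Prop
  | some p => RegularSingularAtFinite L p
  | none => RegularSingularAtFinite (atInfty L) 0

/-- `L` is regular singular: each of its singularities on the projective line is regular. -/
def RegularSingular (L : DiffOp) : Prop := ∀ p : OnePoint ℂ, RegularSingularAt L p

/-- The indicial polynomial of `L` at the finite point `p`,
`∑ i ≤ n, ((x - p) ^ (n - i) * A i / A n)(p) * ρ (ρ - 1) ⋯ (ρ - i + 1)`, in the variable `ρ`. -/
def indicial (L : DiffOp) (p : ℂ) : Polynomial ℂ :=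
  ∑ i ∈ Finset.range (L.natDegree + 1),
    Polynomial.C (RatFunc.eval (RingHom.id ℂ) p (localCoeff L p i)) * descPochhammer ℂ i

/-- The exponents of `L` at a point of the projective line, with multiplicities: the roots of the
indicial polynomial (meant for points that are regular or regular singularities). -/
def exponents (L : DiffOp) : OnePoint ℂ → Multiset ℂ
  | some p => (indicial L p).roots
  | none => (indicial (atInfty L) 0).roots

/-- The absolute value of the exponent difference of a second order operator `L` at `p`, that is
`|e₁ - e₂|` where `e₁`, `e₂` are the exponents of `L` at `p`. It is written as the diameter of the
set `{e₁, e₂}`. -/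
def expDiff (L : DiffOp) (p : OnePoint ℂ) : ℝ := Metric.diam {e : ℂ | e ∈ exponents L p}

theorem expDiff_eq {L : DiffOp} {p : OnePoint ℂ} {e₁ e₂ : ℂ} (h : exponents L p = {e₁, e₂}) :
    expDiff L p = ‖e₁ - e₂‖ := by
  have hs : {e : ℂ | e ∈ exponents L p} = {e₁, e₂} := by
    ext e
    simp [h]
  rw [expDiff, hs, Metric.diam_pair, dist_eq_norm]

/-- The Gauss hypergeometric differential operator
`x (1 - x) ∂ ^ 2 + (b₁ - (a₁ + a₂ + 1) x) ∂ - a₁ a₂`. -/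
def gauss (a₁ a₂ b₁ : ℂ) : DiffOp :=
  Polynomial.monomial 2 (RatFunc.X * (1 - RatFunc.X)) +
    Polynomial.monomial 1 (RatFunc.C b₁ - RatFunc.C (a₁ + a₂ + 1) * RatFunc.X) +
    Polynomial.monomial 0 (-RatFunc.C (a₁ * a₂))

end DiffOp

end

/-!
The proof rests on the normal form of a second order operator. An exp-product turns
`∂² + a₁ ∂ + a₀` into an operator `∂² + Q` without first order term, with the potential
`Q = a₀ - a₁² / 4 - a₁' / 2`, and `Q` is unchanged by every exp-product (`potential_expProduct`).
At a regular point or regular singularity `p` the function `(x - p)² Q` has a value `c`, and the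
discriminant of the indicial polynomial is `1 - 4 c`; so `Δ(L, p)² = |1 - 4 c|` depends on `Q` only
(`HasMonicCoeffs.exists_hasIndicialValue`). This proves the invariance under exp-products.

A change of variables `f` replaces `Q` by `f'² Q(f) + S(f) / 2`, where `S` is the Schwarzian
derivative (`potential_changeVar`). This operation is functorial in `f`
(`potentialPullback_ratComp`), so that the point at infinity, both in the source and in the target,
is reduced to a finite point by composition with `1 / x`. If `f` maps `p` to `q` with ramification
index `e`, comparing leading terms at `p` shows that `1 - 4 c` is multiplied by `e²`
(`IsRamifiedAt.hasValueAt_potentialPullback`), hence `Δ(L, p) = e Δ(L_B, q)`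
(`DiffOp.expDiff_pullback`).

For the hypergeometric operator, `Δ(L_B, q) = 1` unless `q` is `0`, `1` or `∞`, so
`1 - Δ(L, p) = -(e_p - 1) + ∑ᵢ mᵢ(p) (1 - αᵢ)`, where `mᵢ(p)` is the multiplicity of `p` in the
fibre over `i ∈ {0, 1, ∞}`. Summing over `p`, the fibres contribute `deg f` each
(`finsum_fibreMult`), and `∑ (e_p - 1) = 2 deg f - 2` by the Riemann-Hurwitz formula
(`finsum_ramificationMult`). The latter is elementary for a rational function `a / b`: at finite
points `e_p - 1` is the order of vanishing of the Wronskian of `a` and `b`, and at infinity it is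
`2 deg f - 2` minus the degree of the Wronskian.
-/

noncomputable section

/-! ### The derivation and the composition of rational functions -/

theorem ratDeriv_div (a b : Polynomial ℂ) (hb : b ≠ 0) :
    ratDeriv (algebraMap (Polynomial ℂ) (RatFunc ℂ) a / algebraMap (Polynomial ℂ) (RatFunc ℂ) b) =
      algebraMap (Polynomial ℂ) (RatFunc ℂ)
          (Polynomial.derivative a * b - a * Polynomial.derivative b) /
        algebraMap (Polynomial ℂ) (RatFunc ℂ) (b ^ 2) := by
  obtain ⟨g, hg⟩ : ∃ g, g = algebraMap (Polynomial ℂ) (RatFunc ℂ) a /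
    algebraMap (Polynomial ℂ) (RatFunc ℂ) b := ⟨_, rfl⟩
  rw [← hg]
  have hd : g.denom ≠ 0 := RatFunc.denom_ne_zero g
  have hE : g.num * b = a * g.denom := by
    have h := (RatFunc.num_div_denom g).trans hg
    rw [div_eq_div_iff (RatFunc.algebraMap_ne_zero hd) (RatFunc.algebraMap_ne_zero hb),
      ← map_mul, ← map_mul] at h
    exact RatFunc.algebraMap_injective ℂ h
  have hE' := congrArg Polynomial.derivative hE
  rw [Polynomial.derivative_mul, Polynomial.derivative_mul] at hE'
  rw [ratDeriv, div_eq_div_iff (RatFunc.algebraMap_ne_zero (pow_ne_zero 2 hd))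
    (RatFunc.algebraMap_ne_zero (pow_ne_zero 2 hb)), ← map_mul, ← map_mul]
  refine congrArg _ ?_
  linear_combination b * g.denom * hE' -
    (b * Polynomial.derivative g.denom + g.denom * Polynomial.derivative b) * hE

theorem ratDeriv_algebraMap (a : Polynomial ℂ) :
    ratDeriv (algebraMap (Polynomial ℂ) (RatFunc ℂ) a) =
      algebraMap (Polynomial ℂ) (RatFunc ℂ) (Polynomial.derivative a) := by
  simpa using ratDeriv_div a 1 one_ne_zero

theorem ratDeriv_add (g h : RatFunc ℂ) : ratDeriv (g + h) = ratDeriv g + ratDeriv h := by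
  induction g using RatFunc.induction_on with | f a b hb =>
  induction h using RatFunc.induction_on with | f c d hd =>
  have hb' := RatFunc.algebraMap_ne_zero hb
  have hd' := RatFunc.algebraMap_ne_zero hd
  rw [ratDeriv_div a b hb, ratDeriv_div c d hd, div_add_div _ _ hb' hd', ← map_mul, ← map_mul,
    ← map_add, ← map_mul, ratDeriv_div _ _ (mul_ne_zero hb hd)]
  simp only [Polynomial.derivative_mul, map_mul, map_add, map_sub,
    map_pow]
  field_simp
  ring

theorem ratDeriv_mul (g h : RatFunc ℂ) :
    ratDeriv (g * h) = g * ratDeriv h + h * ratDeriv g := by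
  induction g using RatFunc.induction_on with | f a b hb =>
  induction h using RatFunc.induction_on with | f c d hd =>
  have hb' := RatFunc.algebraMap_ne_zero hb
  have hd' := RatFunc.algebraMap_ne_zero hd
  rw [ratDeriv_div a b hb, ratDeriv_div c d hd, div_mul_div_comm, ← map_mul, ← map_mul,
    ratDeriv_div _ _ (mul_ne_zero hb hd)]
  simp only [Polynomial.derivative_mul, map_mul, map_add, map_sub, map_pow]
  field_simp
  ring

theorem ratDeriv_C (c : ℂ) : ratDeriv (RatFunc.C c) = 0 := by
  rw [← RatFunc.algebraMap_C, ratDeriv_algebraMap, Polynomial.derivative_C, map_zero]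

/-- `ratDeriv` as a `ℂ`-linear derivation of the field of rational functions. -/
def ratDerivation : Derivation ℂ (RatFunc ℂ) (RatFunc ℂ) :=
  Derivation.mk'
    { toFun := ratDeriv
      map_add' := ratDeriv_add
      map_smul' := fun c g => by
        rw [RatFunc.smul_eq_C_mul, ratDeriv_mul, ratDeriv_C, RingHom.id_apply,
          RatFunc.smul_eq_C_mul, mul_zero, add_zero] }
    (fun g h => by simpa using ratDeriv_mul g h)

theorem ratDerivation_apply (g : RatFunc ℂ) : ratDerivation g = ratDeriv g := rfl

theorem ratDeriv_zero : ratDeriv 0 = 0 := ratDerivation.map_zero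

theorem ratDeriv_one : ratDeriv 1 = 0 := ratDerivation.map_one_eq_zero

theorem ratDeriv_neg (g : RatFunc ℂ) : ratDeriv (-g) = -ratDeriv g := ratDerivation.map_neg g

theorem ratDeriv_sub (g h : RatFunc ℂ) : ratDeriv (g - h) = ratDeriv g - ratDeriv h :=
  ratDerivation.map_sub g h

theorem ratDeriv_ofNat (n : ℕ) [n.AtLeastTwo] : ratDeriv (OfNat.ofNat n : RatFunc ℂ) = 0 := by
  exact ratDerivation.map_natCast n

theorem ratDeriv_X : ratDeriv RatFunc.X = 1 := by
  rw [← RatFunc.algebraMap_X, ratDeriv_algebraMap, Polynomial.derivative_X, map_one]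

theorem ratDeriv_inv (g : RatFunc ℂ) : ratDeriv g⁻¹ = -ratDeriv g / g ^ 2 := by
  have := ratDerivation.leibniz_inv g
  simp only [ratDerivation_apply, smul_eq_mul] at this
  rw [this]
  field_simp

theorem ratDeriv_div' (g h : RatFunc ℂ) (hh : h ≠ 0) :
    ratDeriv (g / h) = (ratDeriv g * h - g * ratDeriv h) / h ^ 2 := by
  rw [div_eq_mul_inv, ratDeriv_mul, ratDeriv_inv]
  field_simp
  ring

theorem ratDeriv_pow (g : RatFunc ℂ) (n : ℕ) :
    ratDeriv (g ^ n) = (n : RatFunc ℂ) * g ^ (n - 1) * ratDeriv g := by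
  rw [← ratDerivation_apply, ratDerivation.leibniz_pow, nsmul_eq_mul, smul_eq_mul,
    ratDerivation_apply, mul_assoc]

theorem ratDeriv_ne_zero {f : RatFunc ℂ} (hf : ¬ ∃ c, f = RatFunc.C c) : ratDeriv f ≠ 0 := by
  intro h
  rw [ratDeriv, div_eq_zero_iff] at h
  have hd := RatFunc.denom_ne_zero f
  have hw : Polynomial.wronskian f.num f.denom = 0 := by
    rcases h with h | h
    · rw [map_eq_zero_iff _ (RatFunc.algebraMap_injective ℂ)] at h
      rw [Polynomial.wronskian]
      linear_combination -h
    · exact absurd h (RatFunc.algebraMap_ne_zero (pow_ne_zero 2 hd))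
  obtain ⟨h1, h2⟩ := (RatFunc.isCoprime_num_denom f).wronskian_eq_zero_iff.mp hw
  refine hf ((RatFunc.eq_C_iff f).mpr ?_)
  exact ⟨Polynomial.derivative_eq_zero.mp h1,
    Polynomial.derivative_eq_zero.mp h2⟩

/-- Composition on the right with a non-constant rational function, as a field embedding. -/
def ratCompHom (f : RatFunc ℂ) (hf : ¬ ∃ c, f = RatFunc.C c) : RatFunc ℂ →+* RatFunc ℂ :=
  RatFunc.liftRingHom (Polynomial.eval₂RingHom RatFunc.C f) (by
    intro a ha
    rw [Submonoid.mem_comap, mem_nonZeroDivisors_iff_ne_zero]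
    intro h
    refine nonZeroDivisors.ne_zero ha
      ((transcendental_iff.mp (RatFunc.transcendental_of_ne_C f hf)) a ?_)
    simpa [Polynomial.aeval_def] using h)

theorem ratCompHom_apply (f : RatFunc ℂ) (hf : ¬ ∃ c, f = RatFunc.C c) (g : RatFunc ℂ) :
    ratCompHom f hf g = ratComp g f := by
  rw [ratCompHom, RatFunc.liftRingHom_apply]
  rfl

theorem ratCompHom_algebraMap (f : RatFunc ℂ) (hf : ¬ ∃ c, f = RatFunc.C c) (a : Polynomial ℂ) :
    ratCompHom f hf (algebraMap (Polynomial ℂ) (RatFunc ℂ) a) = Polynomial.aeval f a := by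
  rw [ratCompHom, RatFunc.liftRingHom_algebraMap]
  simp [Polynomial.aeval_def]

theorem ratComp_C (c : ℂ) (f : RatFunc ℂ) : ratComp (RatFunc.C c) f = RatFunc.C c :=
  RatFunc.eval_C _ _

theorem ratComp_X (f : RatFunc ℂ) : ratComp RatFunc.X f = f := RatFunc.eval_X _ _

section Comp

variable {f h : RatFunc ℂ}

theorem ratComp_add (hf : ¬ ∃ c, f = RatFunc.C c)
    (a b : RatFunc ℂ) : ratComp (a + b) f = ratComp a f + ratComp b f := by
  simp only [← ratCompHom_apply f hf, map_add]

theorem ratComp_sub (hf : ¬ ∃ c, f = RatFunc.C c)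
    (a b : RatFunc ℂ) : ratComp (a - b) f = ratComp a f - ratComp b f := by
  simp only [← ratCompHom_apply f hf, map_sub]

theorem ratComp_mul (hf : ¬ ∃ c, f = RatFunc.C c)
    (a b : RatFunc ℂ) : ratComp (a * b) f = ratComp a f * ratComp b f := by
  simp only [← ratCompHom_apply f hf, map_mul]

theorem ratComp_div (hf : ¬ ∃ c, f = RatFunc.C c)
    (a b : RatFunc ℂ) : ratComp (a / b) f = ratComp a f / ratComp b f := by
  simp only [← ratCompHom_apply f hf, map_div₀]

theorem ratComp_pow (hf : ¬ ∃ c, f = RatFunc.C c)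
    (a : RatFunc ℂ) (n : ℕ) : ratComp (a ^ n) f = ratComp a f ^ n := by
  simp only [← ratCompHom_apply f hf, map_pow]

theorem ratComp_one (hf : ¬ ∃ c, f = RatFunc.C c) : ratComp 1 f = 1 := by
  simp only [← ratCompHom_apply f hf, map_one]

theorem ratComp_neg (hf : ¬ ∃ c, f = RatFunc.C c)
    (a : RatFunc ℂ) : ratComp (-a) f = -ratComp a f := by
  simp only [← ratCompHom_apply f hf, map_neg]

theorem ratComp_ofNat (hf : ¬ ∃ c, f = RatFunc.C c) (n : ℕ) [n.AtLeastTwo] :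
    ratComp (OfNat.ofNat n : RatFunc ℂ) f = OfNat.ofNat n := by
  simp only [← ratCompHom_apply f hf, map_ofNat]

theorem ratComp_ne_zero (hf : ¬ ∃ c, f = RatFunc.C c)
    {a : RatFunc ℂ} (ha : a ≠ 0) : ratComp a f ≠ 0 := by
  rw [← ratCompHom_apply f hf]
  exact (map_ne_zero _).mpr ha

theorem ratComp_nonconstant (hf : ¬ ∃ c, f = RatFunc.C c)
    (hh : ¬ ∃ c, h = RatFunc.C c) : ¬ ∃ c, ratComp f h = RatFunc.C c := by
  rintro ⟨c, hc⟩
  refine hf ⟨c, (ratCompHom h hh).injective ?_⟩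
  rw [ratCompHom_apply, ratCompHom_apply, hc, ratComp_C]

theorem ratComp_assoc (hf : ¬ ∃ c, f = RatFunc.C c)
    (hh : ¬ ∃ c, h = RatFunc.C c) (g : RatFunc ℂ) :
    ratComp (ratComp g f) h = ratComp g (ratComp f h) := by
  have hfh := ratComp_nonconstant hf hh
  rw [← ratCompHom_apply f hf, ← ratCompHom_apply h hh, ← ratCompHom_apply _ hfh,
    ← RingHom.comp_apply]
  refine DFunLike.congr_fun (IsFractionRing.ringHom_ext (A := Polynomial ℂ) fun a => ?_) g
  rw [RingHom.comp_apply, ratCompHom_algebraMap, ratCompHom_algebraMap,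
    Polynomial.aeval_def, Polynomial.hom_eval₂, Polynomial.aeval_def,
    ratCompHom_apply h hh f]
  congr 1
  ext c : 1
  rw [RingHom.comp_apply, RatFunc.algebraMap_eq_C, ratCompHom_apply, ratComp_C]

/-- The chain rule. -/
theorem ratDeriv_ratComp (hf : ¬ ∃ c, f = RatFunc.C c) (g : RatFunc ℂ) :
    ratDeriv (ratComp g f) = ratComp (ratDeriv g) f * ratDeriv f := by
  have key (a : Polynomial ℂ) : ratDeriv (Polynomial.aeval f a) =
      Polynomial.aeval f (Polynomial.derivative a) * ratDeriv f := by
    exact ratDerivation.map_aeval a f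
  induction g using RatFunc.induction_on with | f a b hb =>
  have hb' : Polynomial.aeval f b ≠ 0 := by
    rw [← ratCompHom_algebraMap f hf]
    exact (map_ne_zero _).mpr (RatFunc.algebraMap_ne_zero hb)
  rw [ratDeriv_div a b hb]
  simp only [← ratCompHom_apply f hf, map_div₀, ratCompHom_algebraMap]
  rw [ratDeriv_div' _ _ hb', key, key]
  simp only [map_sub, map_mul, map_pow]
  field_simp

end Comp

/-! ### The normal form of a second order operator -/

/-- The Schwarzian derivative `(f'' / f')' - (f'' / f')² / 2`. -/
def schwarzian (f : RatFunc ℂ) : RatFunc ℂ :=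
  ratDeriv (ratDeriv (ratDeriv f) / ratDeriv f) - (ratDeriv (ratDeriv f) / ratDeriv f) ^ 2 / 2

/-- The pullback of the potential `Q` of an operator `∂² + Q` along `f`, that is the potential of
the operator without first order term obtained from `∂² + Q` by the change of variables `f` and
an exp-product. -/
def potentialPullback (f Q : RatFunc ℂ) : RatFunc ℂ :=
  ratDeriv f ^ 2 * ratComp Q f + schwarzian f / 2

/-- The cocycle property of the Schwarzian derivative. -/
theorem schwarzian_ratComp {f h : RatFunc ℂ} (hf : ¬ ∃ c, f = RatFunc.C c)
    (hh : ¬ ∃ c, h = RatFunc.C c) :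
    schwarzian (ratComp f h) = ratComp (schwarzian f) h * ratDeriv h ^ 2 + schwarzian h := by
  have hf' := ratDeriv_ne_zero hf
  have hh' := ratDeriv_ne_zero hh
  have hF := ratComp_ne_zero hh hf'
  -- `f'' / f'` satisfies an additive chain rule, from which the one for the Schwarzian follows.
  have hw : ratDeriv (ratDeriv (ratComp f h)) / ratDeriv (ratComp f h) =
      ratComp (ratDeriv (ratDeriv f) / ratDeriv f) h * ratDeriv h +
        ratDeriv (ratDeriv h) / ratDeriv h := by
    rw [ratDeriv_ratComp hh f, ratDeriv_mul, ratDeriv_ratComp hh (ratDeriv f), ratComp_div hh]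
    field_simp
    ring
  have hd : ratDeriv (ratDeriv h) = ratDeriv (ratDeriv h) / ratDeriv h * ratDeriv h := by
    field_simp
  simp only [schwarzian]
  rw [hw]
  generalize ratDeriv (ratDeriv f) / ratDeriv f = P
  rw [ratDeriv_add, ratDeriv_mul, ratDeriv_ratComp hh P, ratComp_sub hh, ratComp_div hh,
    ratComp_pow hh, ratComp_ofNat hh]
  generalize ratDeriv (ratDeriv h) / ratDeriv h = w at *
  rw [hd]
  ring

/-- Pulling back potentials is functorial. -/
theorem potentialPullback_ratComp {f h : RatFunc ℂ} (hf : ¬ ∃ c, f = RatFunc.C c)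
    (hh : ¬ ∃ c, h = RatFunc.C c) (Q : RatFunc ℂ) :
    potentialPullback (ratComp f h) Q = potentialPullback h (potentialPullback f Q) := by
  simp only [potentialPullback]
  rw [schwarzian_ratComp hf hh, ratDeriv_ratComp hh, ratComp_add hh, ratComp_mul hh,
    ratComp_pow hh, ratComp_div hh, ratComp_ofNat hh, ratComp_assoc hf hh]
  ring

namespace DiffOp

/-- The sum defining `lmul` may be extended beyond the order, by zero terms. -/
theorem lmul_eq_sum_range (g h : RatFunc ℂ) (L : DiffOp) {N : ℕ} (hN : L.natDegree < N) :
    lmul g h L = ∑ i ∈ Finset.range N,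
      (Polynomial.monomial (i + 1) (g * L.coeff i) +
        Polynomial.monomial i (g * ratDeriv (L.coeff i) + h * L.coeff i)) := by
  rw [lmul]
  refine Finset.sum_subset (Finset.range_mono hN) fun i _ hi => ?_
  rw [Polynomial.coeff_eq_zero_of_natDegree_lt (by simpa using hi), ratDeriv_zero]
  simp

theorem lmul_one (g h : RatFunc ℂ) :
    lmul g h 1 = Polynomial.monomial 1 g + Polynomial.monomial 0 h := by
  rw [lmul_eq_sum_range g h 1 (N := 1) (by simp)]
  simp [ratDeriv_one]

theorem lmul_lmul_one (g h : RatFunc ℂ) :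
    lmul g h (lmul g h 1) = Polynomial.monomial 2 (g ^ 2) +
      Polynomial.monomial 1 (g * ratDeriv g + 2 * g * h) +
      Polynomial.monomial 0 (g * ratDeriv h + h ^ 2) := by
  rw [lmul_one]
  have hN : (Polynomial.monomial 1 g + Polynomial.monomial 0 h).natDegree < 2 := by
    refine lt_of_le_of_lt (Polynomial.natDegree_add_le _ _) (max_lt ?_ ?_)
    · exact lt_of_le_of_lt (Polynomial.natDegree_monomial_le _) one_lt_two
    · exact lt_of_le_of_lt (Polynomial.natDegree_monomial_le _) two_pos
  rw [lmul_eq_sum_range g h _ hN]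
  ext n
  rcases n with _ | _ | _ | n
  · simp [Finset.sum_range_succ, Polynomial.coeff_monomial, sq]
  · simp [Finset.sum_range_succ, Polynomial.coeff_monomial, -map_pow]
    ring
  · simp [Finset.sum_range_succ, Polynomial.coeff_monomial, sq]
  · simp [Finset.sum_range_succ, Polynomial.coeff_monomial, -map_pow]

theorem substitute_of_natDegree_eq_two (φ : RatFunc ℂ → RatFunc ℂ) (g h : RatFunc ℂ) {L : DiffOp}
    (hL : L.natDegree = 2) :
    substitute φ g h L = Polynomial.monomial 2 (φ (L.coeff 2) * g ^ 2) +
      Polynomial.monomial 1 (φ (L.coeff 2) * (g * ratDeriv g + 2 * g * h) + φ (L.coeff 1) * g) +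
      Polynomial.monomial 0 (φ (L.coeff 2) * (g * ratDeriv h + h ^ 2) + φ (L.coeff 1) * h +
        φ (L.coeff 0)) := by
  rw [substitute, hL]
  simp only [Finset.sum_range_succ, Finset.sum_range_zero, Function.iterate_succ_apply',
    Function.iterate_zero_apply, lmul_lmul_one]
  rw [lmul_one]
  simp only [mul_add, Polynomial.C_mul_monomial, map_add, mul_one, Polynomial.monomial_zero_left,
    map_mul Polynomial.C, map_pow Polynomial.C]
  ring

/-- `L` is the operator `A₂ ∂² + A₁ ∂ + A₀` of order two, with `a₁ = A₁ / A₂` and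
`a₀ = A₀ / A₂`. -/
structure HasMonicCoeffs (L : DiffOp) (a₁ a₀ : RatFunc ℂ) : Prop where
  natDegree_eq : L.natDegree = 2
  coeff_one : L.coeff 1 / L.coeff 2 = a₁
  coeff_zero : L.coeff 0 / L.coeff 2 = a₀

theorem HasMonicCoeffs.coeff_two_ne_zero {L : DiffOp} {a₁ a₀ : RatFunc ℂ}
    (hL : HasMonicCoeffs L a₁ a₀) : L.coeff 2 ≠ 0 := by
  have h : L ≠ 0 := by
    rintro rfl
    simpa using hL.natDegree_eq
  rw [← hL.natDegree_eq]
  exact Polynomial.leadingCoeff_ne_zero.mpr h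

theorem HasMonicCoeffs.C_mul {L : DiffOp} {a₁ a₀ u : RatFunc ℂ} (hL : HasMonicCoeffs L a₁ a₀)
    (hu : u ≠ 0) : HasMonicCoeffs (Polynomial.C u * L) a₁ a₀ := by
  have h2 := hL.coeff_two_ne_zero
  refine ⟨?_, ?_, ?_⟩
  · rw [Polynomial.natDegree_C_mul hu, hL.natDegree_eq]
  · rw [Polynomial.coeff_C_mul, Polynomial.coeff_C_mul, mul_div_mul_left _ _ hu, hL.coeff_one]
  · rw [Polynomial.coeff_C_mul, Polynomial.coeff_C_mul, mul_div_mul_left _ _ hu, hL.coeff_zero]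

theorem hasMonicCoeffs_monomial {A₂ A₁ A₀ : RatFunc ℂ} (h : A₂ ≠ 0) :
    HasMonicCoeffs (Polynomial.monomial 2 A₂ + Polynomial.monomial 1 A₁ + Polynomial.monomial 0 A₀)
      (A₁ / A₂) (A₀ / A₂) := by
  refine ⟨?_, ?_, ?_⟩
  · have : (Polynomial.monomial 1 A₁ + Polynomial.monomial 0 A₀).natDegree < 2 := by
      refine lt_of_le_of_lt (Polynomial.natDegree_add_le _ _) (max_lt ?_ ?_)
      · exact lt_of_le_of_lt (Polynomial.natDegree_monomial_le _) one_lt_two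
      · exact lt_of_le_of_lt (Polynomial.natDegree_monomial_le _) two_pos
    rw [add_assoc, Polynomial.natDegree_add_eq_left_of_natDegree_lt] <;>
      rw [Polynomial.natDegree_monomial_eq 2 h]
    exact this
  · simp [Polynomial.coeff_monomial]
  · simp [Polynomial.coeff_monomial]

theorem HasMonicCoeffs.substitute {L : DiffOp} {a₁ a₀ : RatFunc ℂ} (hL : HasMonicCoeffs L a₁ a₀)
    (φ : RatFunc ℂ →+* RatFunc ℂ) {g h : RatFunc ℂ} (hg : g ≠ 0) :
    HasMonicCoeffs (substitute φ g h L) ((ratDeriv g + 2 * h + φ a₁) / g)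
      ((g * ratDeriv h + h ^ 2 + φ a₁ * h + φ a₀) / g ^ 2) := by
  have h2 : φ (L.coeff 2) ≠ 0 := (map_ne_zero φ).mpr hL.coeff_two_ne_zero
  rw [substitute_of_natDegree_eq_two φ g h hL.natDegree_eq, ← hL.coeff_one, ← hL.coeff_zero,
    map_div₀, map_div₀]
  convert hasMonicCoeffs_monomial (mul_ne_zero h2 (pow_ne_zero 2 hg)) using 1
  · field_simp
  · field_simp

theorem HasMonicCoeffs.expProduct {L L' : DiffOp} {a₁ a₀ r : RatFunc ℂ}
    (hL : HasMonicCoeffs L a₁ a₀) (h : ExpProduct r L L') :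
    HasMonicCoeffs L' (a₁ - 2 * r) (r ^ 2 - ratDeriv r - a₁ * r + a₀) := by
  obtain ⟨u, hu, rfl⟩ := h
  have := (hL.substitute (RingHom.id _) (h := -r) one_ne_zero).C_mul hu
  rw [ratDeriv_one, ratDeriv_neg, RingHom.id_apply, RingHom.id_apply] at this
  convert this using 1
  · rfl
  · ring
  · ring

theorem HasMonicCoeffs.changeVar {L : DiffOp} {a₁ a₀ f : RatFunc ℂ}
    (hL : HasMonicCoeffs L a₁ a₀) (hf : ¬ ∃ c, f = RatFunc.C c) :
    HasMonicCoeffs (changeVar f L)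
      (ratDeriv f * ratComp a₁ f - ratDeriv (ratDeriv f) / ratDeriv f)
      (ratDeriv f ^ 2 * ratComp a₀ f) := by
  have hf' := ratDeriv_ne_zero hf
  have := hL.substitute (ratCompHom f hf) (h := 0) (one_div_ne_zero hf')
  rw [ratDeriv_zero, one_div, ratDeriv_inv, ratCompHom_apply, ratCompHom_apply] at this
  have hs : DiffOp.changeVar f L = DiffOp.substitute (ratCompHom f hf) (ratDeriv f)⁻¹ 0 L := by
    rw [DiffOp.changeVar, one_div]
    congr 1
    ext1 a
    rw [ratCompHom_apply]
  rw [hs]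
  convert this using 1
  · field_simp
    ring
  · field_simp
    ring

/-- The potential of the operator `∂² + Q` obtained from `∂² + a₁ ∂ + a₀` by the exp-product that
removes the first order term. -/
def potential (a₁ a₀ : RatFunc ℂ) : RatFunc ℂ := a₀ - a₁ ^ 2 / 4 - ratDeriv a₁ / 2

theorem potential_expProduct (a₁ a₀ r : RatFunc ℂ) :
    potential (a₁ - 2 * r) (r ^ 2 - ratDeriv r - a₁ * r + a₀) = potential a₁ a₀ := by
  rw [potential, potential, ratDeriv_sub, ratDeriv_mul, ratDeriv_ofNat]
  ring

theorem potential_changeVar (a₁ a₀ : RatFunc ℂ) {f : RatFunc ℂ} (hf : ¬ ∃ c, f = RatFunc.C c) :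
    potential (ratDeriv f * ratComp a₁ f - ratDeriv (ratDeriv f) / ratDeriv f)
      (ratDeriv f ^ 2 * ratComp a₀ f) = potentialPullback f (potential a₁ a₀) := by
  have hf' := ratDeriv_ne_zero hf
  have hd : ratDeriv (ratDeriv f) = ratDeriv (ratDeriv f) / ratDeriv f * ratDeriv f := by
    field_simp
  rw [potential, potentialPullback, potential, schwarzian, ratDeriv_sub, ratDeriv_mul,
    ratDeriv_ratComp hf, ratComp_sub hf, ratComp_sub hf, ratComp_div hf, ratComp_div hf,
    ratComp_pow hf, ratComp_ofNat hf, ratComp_ofNat hf]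
  generalize ratDeriv (ratDeriv f) / ratDeriv f = w at *
  rw [hd]
  ring

end DiffOp

/-! ### Values of rational functions at finite points -/

/-- The rational function `g` has no pole at `p` and takes the value `c` there. -/
def HasValueAt (p : ℂ) (g : RatFunc ℂ) (c : ℂ) : Prop :=
  ∃ a b : Polynomial ℂ, b.eval p ≠ 0 ∧
    g = algebraMap (Polynomial ℂ) (RatFunc ℂ) a / algebraMap (Polynomial ℂ) (RatFunc ℂ) b ∧
    c = a.eval p / b.eval p

theorem Polynomial.ne_zero_of_eval_ne_zero {b : Polynomial ℂ} {p : ℂ} (h : b.eval p ≠ 0) :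
    b ≠ 0 := by
  rintro rfl
  simp at h

namespace HasValueAt

variable {p : ℂ} {g h : RatFunc ℂ} {c d : ℂ}

theorem unique (hc : HasValueAt p g c) (hd : HasValueAt p g d) : c = d := by
  obtain ⟨a, b, hb, hg, rfl⟩ := hc
  obtain ⟨a', b', hb', hg', rfl⟩ := hd
  rw [hg, div_eq_div_iff
    (RatFunc.algebraMap_ne_zero (Polynomial.ne_zero_of_eval_ne_zero hb))
    (RatFunc.algebraMap_ne_zero (Polynomial.ne_zero_of_eval_ne_zero hb')),
    ← map_mul, ← map_mul] at hg'
  have := congrArg (Polynomial.eval p) (RatFunc.algebraMap_injective ℂ hg')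
  rw [Polynomial.eval_mul, Polynomial.eval_mul] at this
  rw [div_eq_div_iff hb hb', this]

theorem of_denom_ne_zero (hg : g.denom.eval p ≠ 0) :
    HasValueAt p g (RatFunc.eval (RingHom.id ℂ) p g) :=
  ⟨g.num, g.denom, hg, (RatFunc.num_div_denom g).symm, rfl⟩

theorem denom_ne_zero (hg : HasValueAt p g c) : g.denom.eval p ≠ 0 := by
  obtain ⟨a, b, hb, rfl, rfl⟩ := hg
  obtain ⟨k, hk⟩ := RatFunc.denom_div_dvd a b
  intro h0
  refine hb ?_
  rw [hk, Polynomial.eval_mul, h0, zero_mul]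

theorem eval_eq (hg : HasValueAt p g c) : RatFunc.eval (RingHom.id ℂ) p g = c :=
  (of_denom_ne_zero hg.denom_ne_zero).unique hg

theorem of_algebraMap (p : ℂ) (a : Polynomial ℂ) :
    HasValueAt p (algebraMap (Polynomial ℂ) (RatFunc ℂ) a) (a.eval p) :=
  ⟨a, 1, by simp, by simp, by simp⟩

theorem C (p c : ℂ) : HasValueAt p (RatFunc.C c) c := by
  simpa using of_algebraMap p (Polynomial.C c)

theorem X (p : ℂ) : HasValueAt p RatFunc.X p := by
  simpa using of_algebraMap p Polynomial.X

theorem natCast (p : ℂ) (n : ℕ) : HasValueAt p (n : RatFunc ℂ) n := by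
  simpa using C p n

theorem one (p : ℂ) : HasValueAt p 1 1 := by
  simpa using C p 1

theorem ofNat (p : ℂ) (n : ℕ) [n.AtLeastTwo] :
    HasValueAt p (OfNat.ofNat n : RatFunc ℂ) (OfNat.ofNat n) := natCast p n

theorem add (hg : HasValueAt p g c) (hh : HasValueAt p h d) : HasValueAt p (g + h) (c + d) := by
  obtain ⟨a, b, hb, rfl, rfl⟩ := hg
  obtain ⟨a', b', hb', rfl, rfl⟩ := hh
  refine ⟨a * b' + b * a', b * b', ?_, ?_, ?_⟩
  · simpa using ⟨hb, hb'⟩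
  · rw [div_add_div _ _ (RatFunc.algebraMap_ne_zero (Polynomial.ne_zero_of_eval_ne_zero hb))
      (RatFunc.algebraMap_ne_zero (Polynomial.ne_zero_of_eval_ne_zero hb'))]
    simp
  · rw [div_add_div _ _ hb hb']
    simp

theorem mul (hg : HasValueAt p g c) (hh : HasValueAt p h d) : HasValueAt p (g * h) (c * d) := by
  obtain ⟨a, b, hb, rfl, rfl⟩ := hg
  obtain ⟨a', b', hb', rfl, rfl⟩ := hh
  refine ⟨a * a', b * b', ?_, ?_, ?_⟩
  · simpa using ⟨hb, hb'⟩
  · rw [div_mul_div_comm, map_mul, map_mul]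
  · rw [div_mul_div_comm, Polynomial.eval_mul, Polynomial.eval_mul]

theorem neg (hg : HasValueAt p g c) : HasValueAt p (-g) (-c) := by
  simpa using (C p (-1)).mul hg

theorem sub (hg : HasValueAt p g c) (hh : HasValueAt p h d) : HasValueAt p (g - h) (c - d) := by
  simpa only [sub_eq_add_neg] using hg.add hh.neg

theorem pow (hg : HasValueAt p g c) (n : ℕ) : HasValueAt p (g ^ n) (c ^ n) := by
  induction n with
  | zero => simpa using one p
  | succ n ih => simpa only [pow_succ] using ih.mul hg

theorem inv (hg : HasValueAt p g c) (hc : c ≠ 0) : HasValueAt p g⁻¹ c⁻¹ := by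
  obtain ⟨a, b, hb, rfl, rfl⟩ := hg
  refine ⟨b, a, ?_, ?_, ?_⟩
  · intro ha
    simp [ha] at hc
  · rw [inv_div]
  · rw [inv_div]

theorem div (hg : HasValueAt p g c) (hh : HasValueAt p h d) (hd : d ≠ 0) :
    HasValueAt p (g / h) (c / d) := by
  simpa only [div_eq_mul_inv] using hg.mul (hh.inv hd)

theorem congr (hg : HasValueAt p g c) (e : h = g) : HasValueAt p h c := e ▸ hg

theorem ne_zero (hg : HasValueAt p g c) (hc : c ≠ 0) : g ≠ 0 := by
  rintro rfl
  exact hc (hg.unique (by simpa using C p 0))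

theorem X_sub_C (p : ℂ) : HasValueAt p (RatFunc.X - RatFunc.C p) 0 := by
  simpa using (X p).sub (C p p)

theorem exists_ratDeriv (hg : HasValueAt p g c) : ∃ d, HasValueAt p (ratDeriv g) d := by
  obtain ⟨a, b, hb, rfl, rfl⟩ := hg
  rw [ratDeriv_div a b (Polynomial.ne_zero_of_eval_ne_zero hb)]
  exact ⟨_, _, _, by simpa using hb, rfl, rfl⟩

theorem ratComp {f : RatFunc ℂ} {q : ℂ} (hf : ¬ ∃ c, f = RatFunc.C c) (hfp : HasValueAt p f q)
    (hg : HasValueAt q g c) : HasValueAt p (ratComp g f) c := by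
  have key (a : Polynomial ℂ) : HasValueAt p (Polynomial.aeval f a) (a.eval q) := by
    induction a using Polynomial.induction_on' with
    | add a b ha hb => simpa using ha.add hb
    | monomial n c =>
      simpa [Polynomial.aeval_monomial] using (C p c).mul (hfp.pow n)
  obtain ⟨a, b, hb, rfl, rfl⟩ := hg
  rw [← ratCompHom_apply f hf, map_div₀, ratCompHom_algebraMap, ratCompHom_algebraMap]
  exact (key a).div (key b) hb

end HasValueAt

/-! ### Exponent differences in terms of the normal form -/

theorem ratFunc_X_sub_C_ne_zero (p : ℂ) : RatFunc.X - RatFunc.C p ≠ 0 := by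
  rw [← RatFunc.algebraMap_X, ← RatFunc.algebraMap_C, ← map_sub]
  exact RatFunc.algebraMap_ne_zero (Polynomial.X_sub_C_ne_zero p)

theorem ratDeriv_X_sub_C (p : ℂ) : ratDeriv (RatFunc.X - RatFunc.C p) = 1 := by
  rw [ratDeriv_sub, ratDeriv_X, ratDeriv_C, sub_zero]

theorem one_div_X_nonconstant : ¬ ∃ c : ℂ, (1 / RatFunc.X : RatFunc ℂ) = RatFunc.C c := by
  rintro ⟨c, hc⟩
  have h : RatFunc.C c * RatFunc.X = (1 : RatFunc ℂ) := by
    rw [← hc, one_div_mul_cancel RatFunc.X_ne_zero]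
  have := ((HasValueAt.C 0 c).mul (HasValueAt.X 0)).unique (h ▸ HasValueAt.one 0)
  simp at this

namespace DiffOp

/-- The value at the point `p` of the projective line of `(x - p)² Q`, where `Q` is the potential
of `∂² + Q`; at `∞` the potential is first pulled back along `1 / x`. If it exists, the exponents
of `∂² + Q` at `p` are the roots of `ρ (ρ - 1) + c`. -/
def HasIndicialValue (Q : RatFunc ℂ) : OnePoint ℂ → ℂ → Prop
  | some p, c => HasValueAt p ((RatFunc.X - RatFunc.C p) ^ 2 * Q) c
  | none, c => HasValueAt 0 ((RatFunc.X - RatFunc.C 0) ^ 2 * potentialPullback (1 / RatFunc.X) Q) c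

theorem HasIndicialValue.unique {Q : RatFunc ℂ} {p : OnePoint ℂ} {c d : ℂ}
    (hc : HasIndicialValue Q p c) (hd : HasIndicialValue Q p d) : c = d := by
  cases p with
  | infty => exact HasValueAt.unique hc hd
  | coe p => exact HasValueAt.unique hc hd

variable {L : DiffOp} {a₁ a₀ : RatFunc ℂ} {p α β : ℂ}

/-- The value is `(1 - D) / 4`, where `D = (α - 1)² - 4 β` is the discriminant of the indicial
polynomial `ρ (ρ - 1) + α ρ + β`. -/
theorem hasValueAt_potential
    (hα : HasValueAt p ((RatFunc.X - RatFunc.C p) * a₁) α)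
    (hβ : HasValueAt p ((RatFunc.X - RatFunc.C p) ^ 2 * a₀) β) :
    HasValueAt p ((RatFunc.X - RatFunc.C p) ^ 2 * potential a₁ a₀)
      ((1 - ((α - 1) ^ 2 - 4 * β)) / 4) := by
  obtain ⟨d, hd⟩ := hα.exists_ratDeriv
  have hX := HasValueAt.X_sub_C p
  have h := (hβ.sub ((hα.pow 2).div (HasValueAt.ofNat p 4) (by norm_num))).sub
    (((hX.mul hd).sub hα).div (HasValueAt.ofNat p 2) two_ne_zero)
  convert h using 1
  · rw [potential, ratDeriv_mul, ratDeriv_X_sub_C]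
    ring
  · ring

theorem HasMonicCoeffs.localCoeff_one (hL : HasMonicCoeffs L a₁ a₀) (p : ℂ) :
    localCoeff L p 1 = (RatFunc.X - RatFunc.C p) * a₁ := by
  rw [localCoeff, Polynomial.leadingCoeff, hL.natDegree_eq, hL.coeff_one]
  simp

theorem HasMonicCoeffs.localCoeff_zero (hL : HasMonicCoeffs L a₁ a₀) (p : ℂ) :
    localCoeff L p 0 = (RatFunc.X - RatFunc.C p) ^ 2 * a₀ := by
  rw [localCoeff, Polynomial.leadingCoeff, hL.natDegree_eq, hL.coeff_zero]

theorem HasMonicCoeffs.localCoeff_two (hL : HasMonicCoeffs L a₁ a₀) (p : ℂ) :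
    localCoeff L p 2 = 1 := by
  rw [localCoeff, Polynomial.leadingCoeff, hL.natDegree_eq, div_self hL.coeff_two_ne_zero]
  simp

/-- The square of the difference of the two exponents is the discriminant of the indicial
polynomial. -/
theorem HasMonicCoeffs.diam_roots_indicial_sq (hL : HasMonicCoeffs L a₁ a₀)
    (hα : HasValueAt p ((RatFunc.X - RatFunc.C p) * a₁) α)
    (hβ : HasValueAt p ((RatFunc.X - RatFunc.C p) ^ 2 * a₀) β) :
    Metric.diam {e : ℂ | e ∈ (indicial L p).roots} ^ 2 = ‖(α - 1) ^ 2 - 4 * β‖ := by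
  obtain ⟨s, hs⟩ := IsAlgClosed.exists_pow_nat_eq ((α - 1) ^ 2 - 4 * β) two_pos
  have hind : indicial L p = (Polynomial.X - Polynomial.C ((1 - α + s) / 2)) *
      (Polynomial.X - Polynomial.C ((1 - α - s) / 2)) := by
    have h2 : descPochhammer ℂ 2 = Polynomial.X * (Polynomial.X - 1) := by
      simp [descPochhammer_succ_right]
    rw [indicial, hL.natDegree_eq]
    simp only [Finset.sum_range_succ, Finset.sum_range_zero]
    rw [hL.localCoeff_zero, hL.localCoeff_one, hL.localCoeff_two, hα.eval_eq, hβ.eval_eq,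
      RatFunc.eval_one, h2, descPochhammer_one, descPochhammer_zero]
    have h1 : (Polynomial.C α : Polynomial ℂ) - 1 =
        -(Polynomial.C ((1 - α + s) / 2) + Polynomial.C ((1 - α - s) / 2)) := by
      rw [← Polynomial.C_1, ← Polynomial.C_sub, ← Polynomial.C_add, ← Polynomial.C_neg]
      congr 1
      ring
    have h0 : (Polynomial.C β : Polynomial ℂ) =
        Polynomial.C ((1 - α + s) / 2) * Polynomial.C ((1 - α - s) / 2) := by
      rw [← Polynomial.C_mul]
      congr 1
      linear_combination hs / 4
    rw [Polynomial.C_1]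
    linear_combination h0 + Polynomial.X * h1
  have hset : {e : ℂ | e ∈ (indicial L p).roots} = {(1 - α + s) / 2, (1 - α - s) / 2} := by
    ext e
    rw [hind, Set.mem_ofPred_eq, Polynomial.roots_mul (mul_ne_zero (Polynomial.X_sub_C_ne_zero _)
      (Polynomial.X_sub_C_ne_zero _)), Polynomial.roots_X_sub_C, Polynomial.roots_X_sub_C]
    simp
  rw [hset, Metric.diam_pair, dist_eq_norm, ← hs, norm_pow]
  congr 2
  ring

theorem HasMonicCoeffs.exists_hasValueAt (hL : HasMonicCoeffs L a₁ a₀)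
    (h : RegularSingularAtFinite L p) :
    ∃ c, HasValueAt p ((RatFunc.X - RatFunc.C p) ^ 2 * potential a₁ a₀) c ∧
      Metric.diam {e : ℂ | e ∈ (indicial L p).roots} ^ 2 = ‖1 - 4 * c‖ := by
  have h1 := HasValueAt.of_denom_ne_zero (h 1 (by rw [hL.natDegree_eq]; norm_num))
  have h0 := HasValueAt.of_denom_ne_zero (h 0 (by rw [hL.natDegree_eq]; norm_num))
  rw [hL.localCoeff_one] at h1
  rw [hL.localCoeff_zero] at h0
  refine ⟨_, hasValueAt_potential h1 h0, ?_⟩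
  rw [hL.diam_roots_indicial_sq h1 h0]
  congr 1
  ring

/-- At a regular point or regular singularity, the exponent difference of a second order operator
is determined by its normal form. -/
theorem HasMonicCoeffs.exists_hasIndicialValue (hL : HasMonicCoeffs L a₁ a₀) {p : OnePoint ℂ}
    (h : RegularSingularAt L p) :
    ∃ c, HasIndicialValue (potential a₁ a₀) p c ∧ expDiff L p ^ 2 = ‖1 - 4 * c‖ := by
  cases p with
  | coe p => exact hL.exists_hasValueAt h
  | infty =>
    obtain ⟨c, hc, hd⟩ := (hL.changeVar one_div_X_nonconstant).exists_hasValueAt h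
    rw [potential_changeVar _ _ one_div_X_nonconstant] at hc
    exact ⟨c, hc, hd⟩

theorem expDiff_nonneg (L : DiffOp) (p : OnePoint ℂ) : 0 ≤ expDiff L p := Metric.diam_nonneg

/-- Exp-products do not change exponent differences, because they do not change the potential of
the normal form. -/
theorem expDiff_eq_of_expProduct {L₁ L₂ : DiffOp} {r : RatFunc ℂ} {p : OnePoint ℂ}
    (hL : L₁.natDegree = 2) (h : ExpProduct r L₁ L₂) (h₁ : RegularSingularAt L₁ p)
    (h₂ : RegularSingularAt L₂ p) : expDiff L₂ p = expDiff L₁ p := by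
  have hM₁ : HasMonicCoeffs L₁ _ _ := ⟨hL, rfl, rfl⟩
  obtain ⟨c, hc, hd⟩ := hM₁.exists_hasIndicialValue h₁
  obtain ⟨c', hc', hd'⟩ := (hM₁.expProduct h).exists_hasIndicialValue h₂
  rw [potential_expProduct] at hc'
  rw [hc'.unique hc, ← hd] at hd'
  exact (pow_left_inj₀ (expDiff_nonneg _ _) (expDiff_nonneg _ _) two_ne_zero).mp hd'

end DiffOp

/-! ### Ramification and the pullback of the normal form -/

/-- The rational function `f` maps the finite point `p` to the finite point `q` with ramification
index `e`, that is, `f - q` is `(x - p) ^ e` times a unit at `p`. -/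
def IsRamifiedAt (f : RatFunc ℂ) (p q : ℂ) (e : ℕ) : Prop :=
  e ≠ 0 ∧ ∃ (u : RatFunc ℂ) (v : ℂ), v ≠ 0 ∧ HasValueAt p u v ∧
    f - RatFunc.C q = (RatFunc.X - RatFunc.C p) ^ e * u

theorem IsRamifiedAt.hasValueAt {f : RatFunc ℂ} {p q : ℂ} {e : ℕ} (h : IsRamifiedAt f p q e) :
    HasValueAt p f q := by
  obtain ⟨he, u, v, -, hu, hfu⟩ := h
  have := (((HasValueAt.X_sub_C p).pow e).mul hu).add (HasValueAt.C p q)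
  rw [← hfu] at this
  simpa [he] using this

/-- The residue of the logarithmic derivative is the order of vanishing. -/
theorem hasValueAt_logDeriv {p v : ℂ} {u : RatFunc ℂ} (n : ℕ) (hu : HasValueAt p u v) (hv : v ≠ 0) :
    HasValueAt p ((RatFunc.X - RatFunc.C p) *
      (ratDeriv ((RatFunc.X - RatFunc.C p) ^ n * u) / ((RatFunc.X - RatFunc.C p) ^ n * u))) n := by
  obtain ⟨d, hd⟩ := hu.exists_ratDeriv
  have h := (HasValueAt.natCast p n).add ((HasValueAt.X_sub_C p).mul (hd.div hu hv))
  convert h using 1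
  · have ht := ratFunc_X_sub_C_ne_zero p
    have hu0 := hu.ne_zero hv
    rw [ratDeriv_mul, ratDeriv_pow, ratDeriv_X_sub_C]
    cases n with
    | zero => simp
    | succ k =>
      rw [Nat.add_sub_cancel]
      field_simp
      ring
  · simp

/-- If `f` is ramified at `p` with index `e`, then `f'` is `(x - p) ^ (e - 1)` times a unit. -/
theorem IsRamifiedAt.exists_ratDeriv_eq {f : RatFunc ℂ} {p q : ℂ} {k : ℕ}
    (h : IsRamifiedAt f p q (k + 1)) :
    ∃ (u : RatFunc ℂ) (v : ℂ), v ≠ 0 ∧ HasValueAt p u v ∧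
      ratDeriv f = (RatFunc.X - RatFunc.C p) ^ k * u := by
  obtain ⟨-, u, v, hv, hu, hfu⟩ := h
  obtain ⟨d, hd⟩ := hu.exists_ratDeriv
  refine ⟨_, _, ?_, ((HasValueAt.natCast p (k + 1)).mul hu).add ((HasValueAt.X_sub_C p).mul hd), ?_⟩
  · rw [zero_mul, add_zero]
    exact mul_ne_zero (Nat.cast_ne_zero.mpr k.succ_ne_zero) hv
  · have := congrArg ratDeriv hfu
    rw [ratDeriv_sub, ratDeriv_C, sub_zero, ratDeriv_mul, ratDeriv_pow, ratDeriv_X_sub_C,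
      Nat.add_sub_cancel] at this
    rw [this]
    ring

/-- Pullback along a map of ramification index `e` multiplies the discriminant `1 - 4 c` of the
indicial polynomial by `e²`. -/
theorem IsRamifiedAt.hasValueAt_potentialPullback {f Q : RatFunc ℂ} {p q c : ℂ} {e : ℕ}
    (hf : ¬ ∃ c, f = RatFunc.C c) (h : IsRamifiedAt f p q e)
    (hQ : HasValueAt q ((RatFunc.X - RatFunc.C q) ^ 2 * Q) c) :
    HasValueAt p ((RatFunc.X - RatFunc.C p) ^ 2 * potentialPullback f Q)
      ((1 - (e : ℂ) ^ 2 * (1 - 4 * c)) / 4) := by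
  obtain ⟨k, rfl⟩ := Nat.exists_eq_succ_of_ne_zero h.1
  obtain ⟨u', v', hv', hu', hfu'⟩ := h.exists_ratDeriv_eq
  have hw := hasValueAt_logDeriv k hu' hv'
  rw [← hfu'] at hw
  obtain ⟨d, hd⟩ := hw.exists_ratDeriv
  -- With `t = x - p` and `w = f'' / f'` one has `t² w' = t (t w)' - t w`, and `t w` takes the value
  -- `e - 1` at `p`. This gives the value of `t²` times half the Schwarzian.
  have hS := ((((HasValueAt.X_sub_C p).mul hd).sub hw).sub
    ((hw.pow 2).div (HasValueAt.ofNat p 2) two_ne_zero)).div (HasValueAt.ofNat p 2) two_ne_zero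
  have hcomp := h.hasValueAt.ratComp hf hQ
  obtain ⟨-, u, v, hv, hu, hfu⟩ := h
  have hl := hasValueAt_logDeriv (k + 1) hu hv
  rw [← hfu, ratDeriv_sub, ratDeriv_C, sub_zero] at hl
  have hfq : f - RatFunc.C q ≠ 0 := fun h0 => hf ⟨q, sub_eq_zero.mp h0⟩
  -- Similarly `t² f'² Q(f) = (t f' / (f - q))² · ((x - q)² Q)(f)`, where `t f' / (f - q)` takes the
  -- value `e`.
  convert ((hl.pow 2).mul hcomp).add hS using 1
  · rw [potentialPullback, schwarzian, ratDeriv_mul, ratDeriv_X_sub_C, ratComp_mul hf,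
      ratComp_pow hf, ratComp_sub hf, ratComp_X, ratComp_C]
    generalize ratDeriv (ratDeriv f) / ratDeriv f = w
    have : ((RatFunc.X - RatFunc.C p) * (ratDeriv f / (f - RatFunc.C q))) ^ 2 *
        ((f - RatFunc.C q) ^ 2 * _root_.ratComp Q f) =
        (RatFunc.X - RatFunc.C p) ^ 2 * (ratDeriv f ^ 2 * _root_.ratComp Q f) := by
      field_simp
    rw [this]
    ring
  · push_cast
    ring

theorem one_div_nonconstant {f : RatFunc ℂ} (hf : ¬ ∃ c, f = RatFunc.C c) :
    ¬ ∃ c, 1 / f = RatFunc.C c := by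
  rintro ⟨c, hc⟩
  refine hf ⟨c⁻¹, ?_⟩
  rw [map_inv₀, ← hc, one_div, inv_inv]

/-- Moving `∞` to `0` in the target of `f`. -/
theorem potentialPullback_one_div {f : RatFunc ℂ} (hf : ¬ ∃ c, f = RatFunc.C c) (Q : RatFunc ℂ) :
    potentialPullback (1 / f) (potentialPullback (1 / RatFunc.X) Q) = potentialPullback f Q := by
  rw [← potentialPullback_ratComp one_div_X_nonconstant (one_div_nonconstant hf),
    ratComp_div (one_div_nonconstant hf), ratComp_one (one_div_nonconstant hf), ratComp_X,
    one_div_one_div]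

/-- The morphism `f` of the projective line maps `p` to `q` with ramification index `e`. The point
at infinity is moved to `0` by `x ↦ 1 / x`, in the source and in the target. -/
def HasRamification (f : RatFunc ℂ) : OnePoint ℂ → OnePoint ℂ → ℕ → Prop
  | some p, some q, e => IsRamifiedAt f p q e
  | some p, none, e => IsRamifiedAt (1 / f) p 0 e
  | none, some q, e => IsRamifiedAt (ratComp f (1 / RatFunc.X)) 0 q e
  | none, none, e => IsRamifiedAt (1 / ratComp f (1 / RatFunc.X)) 0 0 e

namespace DiffOp

theorem HasIndicialValue.potentialPullback {f Q : RatFunc ℂ} {p q : OnePoint ℂ} {c : ℂ} {e : ℕ}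
    (hQ : HasIndicialValue Q q c) (hf : ¬ ∃ c, f = RatFunc.C c) (h : HasRamification f p q e) :
    HasIndicialValue (potentialPullback f Q) p ((1 - (e : ℂ) ^ 2 * (1 - 4 * c)) / 4) := by
  have hf' := ratComp_nonconstant hf one_div_X_nonconstant
  cases p with
  | coe p =>
    cases q with
    | coe q => exact IsRamifiedAt.hasValueAt_potentialPullback hf h hQ
    | infty =>
      have := IsRamifiedAt.hasValueAt_potentialPullback (one_div_nonconstant hf) h hQ
      rwa [potentialPullback_one_div hf] at this
  | infty =>
    cases q with
    | coe q =>
      have := IsRamifiedAt.hasValueAt_potentialPullback hf' h hQ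
      rwa [potentialPullback_ratComp hf one_div_X_nonconstant] at this
    | infty =>
      have := IsRamifiedAt.hasValueAt_potentialPullback (one_div_nonconstant hf') h hQ
      rwa [potentialPullback_one_div hf',
        potentialPullback_ratComp hf one_div_X_nonconstant] at this

/-- A change of variables multiplies exponent differences by the ramification index, and a
subsequent exp-product does not change them. -/
theorem expDiff_pullback {B M L : DiffOp} {a₁ a₀ f r : RatFunc ℂ} {p q : OnePoint ℂ} {e : ℕ}
    (hB : HasMonicCoeffs B a₁ a₀) (hf : ¬ ∃ c, f = RatFunc.C c) (hM : ChangeOfVariables f B M)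
    (hL : ExpProduct r M L) (hBq : RegularSingularAt B q) (hLp : RegularSingularAt L p)
    (h : HasRamification f p q e) : expDiff L p = e * expDiff B q := by
  obtain ⟨u, hu, rfl⟩ := hM
  have hL' := ((hB.changeVar hf).C_mul hu).expProduct hL
  obtain ⟨c, hc, hd⟩ := hL'.exists_hasIndicialValue hLp
  obtain ⟨c', hc', hd'⟩ := hB.exists_hasIndicialValue hBq
  rw [potential_expProduct, potential_changeVar _ _ hf] at hc
  rw [hc.unique (hc'.potentialPullback hf h)] at hd
  refine (pow_left_inj₀ (expDiff_nonneg _ _)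
    (mul_nonneg e.cast_nonneg (expDiff_nonneg _ _)) two_ne_zero).mp ?_
  rw [hd, mul_pow, hd']
  have : 1 - 4 * ((1 - (e : ℂ) ^ 2 * (1 - 4 * c')) / 4) = (e : ℂ) ^ 2 * (1 - 4 * c') := by ring
  rw [this, norm_mul, norm_pow, Complex.norm_natCast]

/-! ### The Gauss hypergeometric operator -/

section Gauss

variable (a₁ a₂ b₁ : ℂ)

theorem hasMonicCoeffs_gauss : HasMonicCoeffs (gauss a₁ a₂ b₁)
    ((RatFunc.C b₁ - RatFunc.C (a₁ + a₂ + 1) * RatFunc.X) / (RatFunc.X * (1 - RatFunc.X)))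
    (-RatFunc.C (a₁ * a₂) / (RatFunc.X * (1 - RatFunc.X))) := by
  refine hasMonicCoeffs_monomial (mul_ne_zero RatFunc.X_ne_zero ?_)
  have := ratFunc_X_sub_C_ne_zero 1
  rw [map_one] at this
  rwa [← neg_ne_zero, neg_sub]

theorem HasMonicCoeffs.regularSingularAtFinite {L : DiffOp} {a₁ a₀ : RatFunc ℂ} {p α β : ℂ}
    (hL : HasMonicCoeffs L a₁ a₀)
    (hα : HasValueAt p ((RatFunc.X - RatFunc.C p) * a₁) α)
    (hβ : HasValueAt p ((RatFunc.X - RatFunc.C p) ^ 2 * a₀) β) : RegularSingularAtFinite L p := by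
  intro i hi
  rw [hL.natDegree_eq] at hi
  interval_cases i
  · rw [hL.localCoeff_zero]
    exact hβ.denom_ne_zero
  · rw [hL.localCoeff_one]
    exact hα.denom_ne_zero

/-- A second order operator with leading local coefficients `α` and `β` at a finite point is
regular singular there, and the square of its exponent difference is `|(α - 1)² - 4 β|`. -/
theorem HasMonicCoeffs.diam_eq {L : DiffOp} {a₁ a₀ : RatFunc ℂ} {p α β δ : ℂ}
    (hL : HasMonicCoeffs L a₁ a₀)
    (hα : HasValueAt p ((RatFunc.X - RatFunc.C p) * a₁) α)
    (hβ : HasValueAt p ((RatFunc.X - RatFunc.C p) ^ 2 * a₀) β) (hδ : (α - 1) ^ 2 - 4 * β = δ ^ 2) :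
    RegularSingularAtFinite L p ∧ Metric.diam {e : ℂ | e ∈ (indicial L p).roots} = ‖δ‖ := by
  refine ⟨hL.regularSingularAtFinite hα hβ, ?_⟩
  refine (pow_left_inj₀ Metric.diam_nonneg (norm_nonneg _) two_ne_zero).mp ?_
  rw [hL.diam_roots_indicial_sq hα hβ, hδ, norm_pow]

theorem one_sub_X_ne_zero : (1 - RatFunc.X : RatFunc ℂ) ≠ 0 :=
  ((HasValueAt.one 0).sub (HasValueAt.X 0)).ne_zero (by norm_num)

theorem expDiff_gauss_zero : RegularSingularAt (gauss a₁ a₂ b₁) ((0 : ℂ) : OnePoint ℂ) ∧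
    expDiff (gauss a₁ a₂ b₁) ((0 : ℂ) : OnePoint ℂ) = ‖1 - b₁‖ := by
  have hX := HasValueAt.X 0
  have h1X := (HasValueAt.one 0).sub hX
  have hX0 : (RatFunc.X : RatFunc ℂ) ≠ 0 := RatFunc.X_ne_zero
  have hα := ((HasValueAt.C 0 b₁).sub ((HasValueAt.C 0 (a₁ + a₂ + 1)).mul hX)).div h1X (by norm_num)
  have hβ := (hX.mul (HasValueAt.C 0 (a₁ * a₂)).neg).div h1X (by norm_num)
  refine (hasMonicCoeffs_gauss a₁ a₂ b₁).diam_eq (δ := 1 - b₁) (hα.congr ?_) (hβ.congr ?_) ?_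
  · have := one_sub_X_ne_zero
    rw [map_zero]
    field_simp
    ring
  · have := one_sub_X_ne_zero
    rw [map_zero]
    field_simp
    ring
  · ring

theorem expDiff_gauss_one : RegularSingularAt (gauss a₁ a₂ b₁) ((1 : ℂ) : OnePoint ℂ) ∧
    expDiff (gauss a₁ a₂ b₁) ((1 : ℂ) : OnePoint ℂ) = ‖b₁ - a₁ - a₂‖ := by
  have hX := HasValueAt.X 1
  have hX0 : (RatFunc.X : RatFunc ℂ) ≠ 0 := RatFunc.X_ne_zero
  have hα := ((HasValueAt.C 1 b₁).sub ((HasValueAt.C 1 (a₁ + a₂ + 1)).mul hX)).neg.div hX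
    one_ne_zero
  have hβ := (((HasValueAt.one 1).sub hX).mul (HasValueAt.C 1 (a₁ * a₂)).neg).div hX one_ne_zero
  refine (hasMonicCoeffs_gauss a₁ a₂ b₁).diam_eq (δ := b₁ - a₁ - a₂) (hα.congr ?_) (hβ.congr ?_) ?_
  · have := one_sub_X_ne_zero
    rw [map_one]
    field_simp
    ring
  · have := one_sub_X_ne_zero
    rw [map_one]
    field_simp
    ring
  · ring

theorem expDiff_gauss_coe {q : ℂ} (hq0 : q ≠ 0) (hq1 : q ≠ 1) :
    RegularSingularAt (gauss a₁ a₂ b₁) (q : OnePoint ℂ) ∧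
      expDiff (gauss a₁ a₂ b₁) (q : OnePoint ℂ) = 1 := by
  have hX := HasValueAt.X q
  have hd := hX.mul ((HasValueAt.one q).sub hX)
  have hd0 : q * (1 - q) ≠ 0 := mul_ne_zero hq0 (sub_ne_zero.mpr hq1.symm)
  have ht := HasValueAt.X_sub_C q
  have hα := ht.mul
    (((HasValueAt.C q b₁).sub ((HasValueAt.C q (a₁ + a₂ + 1)).mul hX)).div hd hd0)
  have hβ := (ht.pow 2).mul ((HasValueAt.C q (a₁ * a₂)).neg.div hd hd0)
  have := (hasMonicCoeffs_gauss a₁ a₂ b₁).diam_eq (δ := 1) hα hβ (by ring)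
  rwa [norm_one] at this

theorem expDiff_gauss_infty : RegularSingularAt (gauss a₁ a₂ b₁) OnePoint.infty ∧
    expDiff (gauss a₁ a₂ b₁) OnePoint.infty = ‖a₁ - a₂‖ := by
  have hX := HasValueAt.X 0
  have hX1 := hX.sub (HasValueAt.one 0)
  have hX0 : (RatFunc.X : RatFunc ℂ) ≠ 0 := RatFunc.X_ne_zero
  have h1 : (RatFunc.X - 1 : RatFunc ℂ) ≠ 0 := hX1.ne_zero (by norm_num)
  have hN := one_div_X_nonconstant
  have hd1 : ratDeriv (1 / RatFunc.X) = -1 / RatFunc.X ^ 2 := by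
    rw [ratDeriv_div' _ _ hX0, ratDeriv_one, ratDeriv_X]
    ring
  have hd2 : ratDeriv (ratDeriv (1 / RatFunc.X)) = 2 / RatFunc.X ^ 3 := by
    rw [hd1, ratDeriv_div' _ _ (pow_ne_zero 2 hX0), ratDeriv_neg, ratDeriv_one, ratDeriv_pow,
      ratDeriv_X]
    field_simp
    simp [mul_comm]
  have hα := (HasValueAt.ofNat 0 2).sub
    (((((HasValueAt.C 0 b₁).mul hX).sub (HasValueAt.C 0 (a₁ + a₂ + 1))).div hX1 (by norm_num)))
  have hβ := (HasValueAt.C 0 (a₁ * a₂)).neg.div hX1 (by norm_num)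
  refine ((hasMonicCoeffs_gauss a₁ a₂ b₁).changeVar hN).diam_eq (δ := a₁ - a₂)
    (hα.congr ?_) (hβ.congr ?_) ?_
  · rw [hd2, hd1, ratComp_div hN, ratComp_sub hN, ratComp_mul hN, ratComp_mul hN, ratComp_sub hN,
      ratComp_one hN, ratComp_X, ratComp_C, ratComp_C, map_zero, sub_zero]
    field_simp
    ring
  · rw [hd1, ratComp_div hN, ratComp_neg hN, ratComp_mul hN, ratComp_sub hN,
      ratComp_one hN, ratComp_X, ratComp_C, map_zero, sub_zero]
    field_simp
  · ring

theorem regularSingular_gauss : RegularSingular (gauss a₁ a₂ b₁) := by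
  intro p
  cases p with
  | infty => exact (expDiff_gauss_infty a₁ a₂ b₁).1
  | coe q =>
    by_cases h0 : q = 0
    · exact h0 ▸ (expDiff_gauss_zero a₁ a₂ b₁).1
    by_cases h1 : q = 1
    · exact h1 ▸ (expDiff_gauss_one a₁ a₂ b₁).1
    exact (expDiff_gauss_coe a₁ a₂ b₁ h0 h1).1

end Gauss

end DiffOp

/-! ### Fibres of a rational function and the Riemann-Hurwitz formula -/

namespace Polynomial

/-- If `a` vanishes at `p` to the order `k + 1` and `b` does not vanish there, then the Wronskian
of `a` and `b` vanishes at `p` to the order `k`. -/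
theorem rootMultiplicity_wronskian {a b : ℂ[X]} {p : ℂ} (ha : a ≠ 0) (hap : a.eval p = 0)
    (hb : b.eval p ≠ 0) :
    rootMultiplicity p a = rootMultiplicity p (wronskian a b) + 1 := by
  obtain ⟨u, hu, hpu⟩ := exists_eq_pow_rootMultiplicity_mul_and_not_dvd a ha p
  have hm : 0 < rootMultiplicity p a := (rootMultiplicity_pos ha).mpr hap
  obtain ⟨k, hk⟩ := Nat.exists_eq_succ_of_ne_zero hm.ne'
  rw [hk] at hu ⊢
  have hW : wronskian a b = ((X - C p) * (u * derivative b - derivative u * b) -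
      C ((k : ℂ) + 1) * u * b) * (X - C p) ^ k := by
    rw [wronskian, hu]
    simp only [derivative_mul, derivative_X_sub_C_pow, Nat.succ_eq_add_one, Nat.add_sub_cancel]
    push_cast
    rw [map_add, map_natCast, map_one]
    ring
  have hV : ((X - C p) * (u * derivative b - derivative u * b) -
      C ((k : ℂ) + 1) * u * b).eval p ≠ 0 := by
    rw [dvd_iff_isRoot] at hpu
    simpa using ⟨⟨Nat.cast_add_one_ne_zero k, hpu⟩, hb⟩
  have hV0 := ne_zero_of_eval_ne_zero hV
  rw [hW, rootMultiplicity_mul_X_sub_C_pow hV0, rootMultiplicity_eq_zero hV, zero_add]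

/-- As the degrees of `a` and `b` differ, the top coefficients of `a b'` and `a' b` do not
cancel. -/
theorem natDegree_wronskian_of_natDegree_lt {a b : ℂ[X]} (ha : a ≠ 0)
    (hab : a.natDegree < b.natDegree) :
    (wronskian a b).natDegree + 1 = a.natDegree + b.natDegree := by
  obtain ⟨m, hm⟩ := Nat.exists_eq_succ_of_ne_zero (Nat.ne_zero_of_lt hab)
  have hb : b ≠ 0 := by
    rintro rfl
    simp at hab
  have h1 : (a * derivative b).coeff (a.natDegree + m) =
      a.leadingCoeff * b.leadingCoeff * b.natDegree := by
    rw [coeff_mul_add_eq_of_natDegree_le le_rfl, coeff_derivative, leadingCoeff, leadingCoeff, hm]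
    · push_cast
      ring
    · exact (natDegree_derivative_le b).trans (by omega)
  have h2 : (derivative a * b).coeff (a.natDegree + m) =
      a.leadingCoeff * b.leadingCoeff * a.natDegree := by
    by_cases h0 : a.natDegree = 0
    · rw [derivative_eq_zero.mpr h0, h0]
      simp
    · obtain ⟨n, hn⟩ := Nat.exists_eq_succ_of_ne_zero h0
      have : a.natDegree + m = n + b.natDegree := by omega
      rw [this, coeff_mul_add_eq_of_natDegree_le _ le_rfl, coeff_derivative, leadingCoeff,
        leadingCoeff, hn]
      · push_cast
        ring
      · exact (natDegree_derivative_le a).trans (by omega)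
  have hc : (wronskian a b).coeff (a.natDegree + m) ≠ 0 := by
    rw [wronskian, coeff_sub, h1, h2, ← mul_sub]
    refine mul_ne_zero (mul_ne_zero (leadingCoeff_ne_zero.mpr ha) (leadingCoeff_ne_zero.mpr hb)) ?_
    rw [sub_ne_zero]
    exact_mod_cast hab.ne'
  have hlt := natDegree_wronskian_lt_add (a := a) (b := b) fun h0 => hc (by rw [h0, coeff_zero])
  have hle := le_natDegree_of_ne_zero hc
  omega

theorem reflect_eq_X_pow_mul_reverse {a : ℂ[X]} {d : ℕ} (h : a.natDegree ≤ d) :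
    reflect d a = X ^ (d - a.natDegree) * reverse a := by
  have := reflect_mul (1 : ℂ[X]) a (F := d - a.natDegree) (G := a.natDegree) (by simp) le_rfl
  rwa [one_mul, reflect_one, Nat.sub_add_cancel h] at this

/-- Substituting `1 / x` in a polynomial of degree at most `d` reverses its coefficients, up to the
factor `x ^ (-d)`. -/
theorem aeval_one_div_X {a : ℂ[X]} {d : ℕ} (h : a.natDegree ≤ d) :
    aeval (1 / RatFunc.X : RatFunc ℂ) a =
      algebraMap ℂ[X] (RatFunc ℂ) (reflect d a) * (1 / RatFunc.X) ^ d := by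
  have hX : (RatFunc.X : RatFunc ℂ) ≠ 0 := RatFunc.X_ne_zero
  let _ : Invertible (1 / RatFunc.X : RatFunc ℂ) := invertibleOfNonzero (one_div_ne_zero hX)
  have := eval₂_reflect_mul_pow (algebraMap ℂ (RatFunc ℂ)) (1 / RatFunc.X) d a h
  rw [aeval_def, ← this, invOf_eq_inv, one_div, inv_inv, ← aeval_def,
    RatFunc.aeval_X_left_eq_algebraMap]

theorem finite_support_rootMultiplicity {a : ℂ[X]} (ha : a ≠ 0) :
    (Function.support fun p => (rootMultiplicity p a : ℝ)).Finite := by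
  refine (a.roots.toFinset.finite_toSet).subset fun p hp => ?_
  simp only [Function.mem_support, ne_eq, Nat.cast_eq_zero] at hp
  simpa [ha] using (rootMultiplicity_pos ha).mp (Nat.pos_of_ne_zero hp)

/-- Over `ℂ` the multiplicities of the roots add up to the degree. -/
theorem finsum_rootMultiplicity {a : ℂ[X]} (ha : a ≠ 0) :
    ∑ᶠ p, (rootMultiplicity p a : ℝ) = a.natDegree := by
  rw [finsum_eq_sum_of_support_subset (s := a.roots.toFinset) _ fun p hp => ?_]
  · simp only [← count_roots]
    rw [← Nat.cast_sum, Multiset.toFinset_sum_count_eq,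
      (IsAlgClosed.splits a).natDegree_eq_card_roots]
  · simp only [Function.mem_support, ne_eq, Nat.cast_eq_zero] at hp
    simpa [ha] using (rootMultiplicity_pos ha).mp (Nat.pos_of_ne_zero hp)

theorem eval_zero_reflect (a : ℂ[X]) (d : ℕ) : (reflect d a).eval 0 = a.coeff d := by
  rw [← coeff_zero_eq_eval_zero, coeff_reflect, revAt_le (Nat.zero_le d), Nat.sub_zero]

theorem eval_zero_reverse_ne_zero {a : ℂ[X]} (ha : a ≠ 0) : (reverse a).eval 0 ≠ 0 := by
  rw [← coeff_zero_eq_eval_zero, coeff_zero_reverse]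
  exact leadingCoeff_ne_zero.mpr ha

theorem natDegree_lt_of_coeff_eq_zero {a : ℂ[X]} {d : ℕ} (hd : 0 < d) (h : a.natDegree ≤ d)
    (h0 : a.coeff d = 0) : a.natDegree < d := by
  refine lt_of_le_of_ne h fun he => ?_
  rw [← he, coeff_natDegree, leadingCoeff_eq_zero] at h0
  rw [h0, natDegree_zero] at he
  omega

end Polynomial

open Polynomial in
/-- A local equation of ramification given by polynomials. -/
theorem isRamifiedAt_of_div {f : RatFunc ℂ} {p q : ℂ} {a b : ℂ[X]}
    (hf : f = algebraMap ℂ[X] (RatFunc ℂ) a / algebraMap ℂ[X] (RatFunc ℂ) b) (hb : b.eval p ≠ 0)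
    {e : ℕ} (he : e ≠ 0) {u : ℂ[X]} (hu : u.eval p ≠ 0)
    (h : a - C q * b = (X - C p) ^ e * u) : IsRamifiedAt f p q e := by
  have hb0 := RatFunc.algebraMap_ne_zero (ne_zero_of_eval_ne_zero hb)
  refine ⟨he, _, _, div_ne_zero hu hb, (HasValueAt.of_algebraMap p u).div
    (HasValueAt.of_algebraMap p b) hb, ?_⟩
  have h' := congrArg (algebraMap ℂ[X] (RatFunc ℂ)) h
  simp only [map_sub, map_mul, map_pow, RatFunc.algebraMap_X, RatFunc.algebraMap_C] at h'
  rw [hf, mul_div_assoc', ← h']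
  field_simp

theorem Set.Finite.of_option {α : Type*} {φ : Option α → ℝ}
    (h : (Function.support fun a => φ (some a)).Finite) : (Function.support φ).Finite := by
  refine ((h.image some).insert none).subset fun p hp => ?_
  cases p with
  | none => exact Set.mem_insert _ _
  | some a => exact Set.mem_insert_of_mem _ ⟨a, hp, rfl⟩

section Fibre

open Polynomial

/-- A polynomial whose roots are the finite points of the fibre of `f` over `q`, with
multiplicities. -/
def fibrePoly (f : RatFunc ℂ) : OnePoint ℂ → ℂ[X]
  | some q => f.num - C q * f.denom
  | none => f.denom

/-- The multiplicity of the point `p` in the fibre of `f` over `q`, zero if `p` is not in it. The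
multiplicity of `∞` is the drop of the degree of `fibrePoly f q` below the degree of `f`. -/
def fibreMult (f : RatFunc ℂ) (q : OnePoint ℂ) : OnePoint ℂ → ℕ
  | some p => rootMultiplicity p (fibrePoly f q)
  | none => ratDegree f - (fibrePoly f q).natDegree

/-- The multiplicity of the point `p` in the ramification divisor of `f`, which is given at finite
points by the Wronskian of numerator and denominator. The subtraction at `∞` does not truncate for
non-constant `f`: the Wronskian has degree at most `2 * ratDegree f - 2`. -/
def ramificationMult (f : RatFunc ℂ) : OnePoint ℂ → ℕ
  | some p => rootMultiplicity p (wronskian f.num f.denom)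
  | none => 2 * ratDegree f - 2 - (wronskian f.num f.denom).natDegree

variable {f : RatFunc ℂ}

theorem fibrePoly_ne_zero (hf : ¬ ∃ c, f = RatFunc.C c) (q : OnePoint ℂ) : fibrePoly f q ≠ 0 := by
  cases q with
  | infty => exact RatFunc.denom_ne_zero f
  | coe q =>
    intro h
    refine hf ⟨q, ?_⟩
    have h' := congrArg (algebraMap ℂ[X] (RatFunc ℂ)) (sub_eq_zero.mp h)
    rw [map_mul, RatFunc.algebraMap_C] at h'
    rw [← RatFunc.num_div_denom f, h',
      mul_div_cancel_right₀ _ (RatFunc.algebraMap_ne_zero (RatFunc.denom_ne_zero f))]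

theorem natDegree_fibrePoly_le (f : RatFunc ℂ) (q : OnePoint ℂ) :
    (fibrePoly f q).natDegree ≤ ratDegree f := by
  cases q with
  | infty => exact le_max_right _ _
  | coe q =>
    exact (natDegree_sub_le _ _).trans (max_le_max le_rfl (natDegree_C_mul_le _ _))

theorem ratDegree_pos (hf : ¬ ∃ c, f = RatFunc.C c) : 0 < ratDegree f := by
  by_contra h
  have h0 : ratDegree f = 0 := by omega
  rw [ratDegree] at h0
  exact hf ((RatFunc.eq_C_iff f).mpr (by omega))

theorem wronskian_num_denom_ne_zero (hf : ¬ ∃ c, f = RatFunc.C c) :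
    wronskian f.num f.denom ≠ 0 := by
  intro h
  obtain ⟨h1, h2⟩ := (RatFunc.isCoprime_num_denom f).wronskian_eq_zero_iff.mp h
  exact hf ((RatFunc.eq_C_iff f).mpr ⟨derivative_eq_zero.mp h1, derivative_eq_zero.mp h2⟩)

theorem wronskian_fibrePoly_coe (f : RatFunc ℂ) (q : ℂ) :
    wronskian (fibrePoly f (q : OnePoint ℂ)) f.denom = wronskian f.num f.denom := by
  change wronskian (f.num - C q * f.denom) f.denom = _
  rw [wronskian, wronskian, derivative_sub, derivative_C_mul]
  ring

theorem one_div_eq_denom_div_num (f : RatFunc ℂ) :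
    1 / f = algebraMap ℂ[X] (RatFunc ℂ) f.denom / algebraMap ℂ[X] (RatFunc ℂ) f.num := by
  conv_lhs => rw [← RatFunc.num_div_denom f]
  rw [one_div_div]

/-- The image `q` of a finite point under `f`; the last conjunct compares the ramification index
with the order of the Wronskian. -/
theorem exists_hasRamification_coe (hf : ¬ ∃ c, f = RatFunc.C c) (p : ℂ) :
    ∃ q, HasRamification f p q (fibreMult f q p) ∧ (∀ q' ≠ q, fibreMult f q' p = 0) ∧
      fibreMult f q p = ramificationMult f p + 1 := by
  by_cases hb : f.denom.eval p = 0
  · have ha : f.num.eval p ≠ 0 := by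
      intro ha
      obtain ⟨u, v, huv⟩ := RatFunc.isCoprime_num_denom f
      simpa [ha, hb] using congrArg (eval p) huv
    refine ⟨OnePoint.infty, ?_, ?_, ?_⟩
    · obtain ⟨u, hu, hpu⟩ := exists_eq_pow_rootMultiplicity_mul_and_not_dvd f.denom
        (RatFunc.denom_ne_zero f) p
      refine isRamifiedAt_of_div (one_div_eq_denom_div_num f) ha ?_ (u := u) ?_ ?_
      · exact ((rootMultiplicity_pos (RatFunc.denom_ne_zero f)).mpr hb).ne'
      · rwa [dvd_iff_isRoot] at hpu
      · rw [C_0, zero_mul, sub_zero]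
        exact hu
    · intro q' hq'
      obtain ⟨q', rfl⟩ := OnePoint.ne_infty_iff_exists.mp hq'
      refine rootMultiplicity_eq_zero ?_
      change ¬ (f.num - C q' * f.denom).IsRoot p
      simpa [hb] using ha
    · -- The pair `f.denom`, `-f.num` has the same Wronskian as `f.num`, `f.denom`.
      have ha' : (-f.num).eval p ≠ 0 := by rwa [eval_neg, neg_ne_zero]
      have := rootMultiplicity_wronskian (RatFunc.denom_ne_zero f) hb ha'
      rwa [wronskian_neg_right, wronskian_neg_eq] at this
  · obtain ⟨q, hq⟩ : ∃ q, q = f.num.eval p / f.denom.eval p := ⟨_, rfl⟩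
    have hA0 := fibrePoly_ne_zero hf (q : OnePoint ℂ)
    have hAp : (fibrePoly f (q : OnePoint ℂ)).eval p = 0 := by
      change (f.num - C q * f.denom).eval p = 0
      rw [eval_sub, eval_mul, eval_C, hq, div_mul_cancel₀ _ hb, sub_self]
    refine ⟨(q : OnePoint ℂ), ?_, ?_, ?_⟩
    · obtain ⟨u, hu, hpu⟩ := exists_eq_pow_rootMultiplicity_mul_and_not_dvd _ hA0 p
      refine isRamifiedAt_of_div (RatFunc.num_div_denom f).symm hb ?_ (u := u) ?_ hu
      · exact ((rootMultiplicity_pos hA0).mpr hAp).ne'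
      · rwa [dvd_iff_isRoot] at hpu
    · intro q' hq'
      refine rootMultiplicity_eq_zero ?_
      cases q' with
      | infty => exact hb
      | coe q' =>
        change ¬ (f.num - C q' * f.denom).eval p = 0
        rw [eval_sub, eval_mul, eval_C, sub_eq_zero, ← div_eq_iff hb, ← hq]
        exact fun h => hq' (congrArg _ h.symm)
    · have := rootMultiplicity_wronskian hA0 hAp hb
      rwa [wronskian_fibrePoly_coe] at this

theorem ratComp_one_div_X (f : RatFunc ℂ) : ratComp f (1 / RatFunc.X) =
    algebraMap ℂ[X] (RatFunc ℂ) (reflect (ratDegree f) f.num) /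
      algebraMap ℂ[X] (RatFunc ℂ) (reflect (ratDegree f) f.denom) := by
  have hX : (RatFunc.X : RatFunc ℂ) ≠ 0 := RatFunc.X_ne_zero
  have h : ratComp f (1 / RatFunc.X) =
      aeval (1 / RatFunc.X : RatFunc ℂ) f.num / aeval (1 / RatFunc.X : RatFunc ℂ) f.denom := rfl
  rw [h, aeval_one_div_X (le_max_left _ _ : _ ≤ ratDegree f),
    aeval_one_div_X (le_max_right _ _ : _ ≤ ratDegree f),
    mul_div_mul_right _ _ (pow_ne_zero _ (one_div_ne_zero hX)), ratDegree]

/-- The image `q` of the point at infinity under `f`; the last conjunct compares the ramification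
index with the degree of the Wronskian. -/
theorem exists_hasRamification_infty (hf : ¬ ∃ c, f = RatFunc.C c) :
    ∃ q, HasRamification f OnePoint.infty q (fibreMult f q OnePoint.infty) ∧
      (∀ q' ≠ q, fibreMult f q' OnePoint.infty = 0) ∧
      fibreMult f q OnePoint.infty + (wronskian f.num f.denom).natDegree + 1 = 2 * ratDegree f := by
  have hd := ratDegree_pos hf
  have hna : f.num.natDegree ≤ ratDegree f := le_max_left _ _
  have hnb : f.denom.natDegree ≤ ratDegree f := le_max_right _ _
  -- In the variable `1 / x` the coefficient of degree `ratDegree f` becomes the value at `0`.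
  by_cases hb : f.denom.coeff (ratDegree f) = 0
  · have hlt := natDegree_lt_of_coeff_eq_zero hd hnb hb
    have hda : f.num.natDegree = ratDegree f := by
      rw [ratDegree] at hlt ⊢
      omega
    have ha : f.num.coeff (ratDegree f) ≠ 0 := by
      rw [← hda, coeff_natDegree, leadingCoeff_ne_zero]
      rintro h
      rw [h, natDegree_zero] at hda
      omega
    refine ⟨OnePoint.infty, ?_, ?_, ?_⟩
    · refine isRamifiedAt_of_div (b := reflect (ratDegree f) f.num)
        (a := reflect (ratDegree f) f.denom) ?_ ?_ (Nat.sub_pos_of_lt hlt).ne'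
        (u := reverse f.denom) (eval_zero_reverse_ne_zero (RatFunc.denom_ne_zero f)) ?_
      · rw [ratComp_one_div_X, one_div_div]
      · rwa [eval_zero_reflect]
      · rw [C_0, zero_mul, sub_zero, sub_zero]
        exact reflect_eq_X_pow_mul_reverse hnb
    · intro q' hq'
      obtain ⟨q', rfl⟩ := OnePoint.ne_infty_iff_exists.mp hq'
      refine Nat.sub_eq_zero_of_le (le_natDegree_of_ne_zero ?_)
      change (f.num - C q' * f.denom).coeff (ratDegree f) ≠ 0
      rwa [coeff_sub, coeff_C_mul, hb, mul_zero, sub_zero]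
    · have := natDegree_wronskian_of_natDegree_lt (RatFunc.denom_ne_zero f) (hlt.trans_eq hda.symm)
      rw [← wronskian_neg_eq, natDegree_neg, hda] at this
      change ratDegree f - f.denom.natDegree + _ + 1 = _
      omega
  · obtain ⟨q, hq⟩ : ∃ q, q = f.num.coeff (ratDegree f) / f.denom.coeff (ratDegree f) := ⟨_, rfl⟩
    have hA0 := fibrePoly_ne_zero hf (q : OnePoint ℂ)
    have hAd := natDegree_fibrePoly_le f (q : OnePoint ℂ)
    have hlt : (fibrePoly f (q : OnePoint ℂ)).natDegree < ratDegree f := by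
      refine natDegree_lt_of_coeff_eq_zero hd hAd ?_
      change (f.num - C q * f.denom).coeff (ratDegree f) = 0
      rw [coeff_sub, coeff_C_mul, hq, div_mul_cancel₀ _ hb, sub_self]
    have hdb : f.denom.natDegree = ratDegree f := le_antisymm hnb (le_natDegree_of_ne_zero hb)
    refine ⟨(q : OnePoint ℂ), ?_, ?_, ?_⟩
    · refine isRamifiedAt_of_div (ratComp_one_div_X f) ?_ (Nat.sub_pos_of_lt hlt).ne'
        (u := reverse (fibrePoly f (q : OnePoint ℂ))) (eval_zero_reverse_ne_zero hA0) ?_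
      · rwa [eval_zero_reflect]
      · rw [← reflect_C_mul, ← reflect_sub, C_0, sub_zero]
        exact reflect_eq_X_pow_mul_reverse hAd
    · intro q' hq'
      refine Nat.sub_eq_zero_of_le (le_natDegree_of_ne_zero ?_)
      cases q' with
      | infty => exact hb
      | coe q' =>
        change (f.num - C q' * f.denom).coeff (ratDegree f) ≠ 0
        rw [coeff_sub, coeff_C_mul, sub_ne_zero, ne_eq, ← div_eq_iff hb, ← hq]
        exact fun h => hq' (congrArg _ h.symm)
    · have := natDegree_wronskian_of_natDegree_lt hA0 (hlt.trans_eq hdb.symm)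
      rw [wronskian_fibrePoly_coe, hdb] at this
      change ratDegree f - (fibrePoly f (q : OnePoint ℂ)).natDegree + _ + 1 = _
      omega

/-- Every point of the projective line lies in exactly one fibre of `f`, and its multiplicity in
that fibre is the ramification index. -/
theorem exists_hasRamification (hf : ¬ ∃ c, f = RatFunc.C c) (p : OnePoint ℂ) :
    ∃ q, HasRamification f p q (fibreMult f q p) ∧ (∀ q' ≠ q, fibreMult f q' p = 0) ∧
      fibreMult f q p = ramificationMult f p + 1 := by
  cases p with
  | coe p => exact exists_hasRamification_coe hf p
  | infty =>
    obtain ⟨q, h1, h2, h3⟩ := exists_hasRamification_infty hf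
    refine ⟨q, h1, h2, ?_⟩
    have : fibreMult f q OnePoint.infty ≠ 0 := by
      cases q with
      | coe q => exact h1.1
      | infty => exact h1.1
    change _ = 2 * ratDegree f - 2 - (wronskian f.num f.denom).natDegree + 1
    omega

theorem finite_support_fibreMult (hf : ¬ ∃ c, f = RatFunc.C c) (q : OnePoint ℂ) :
    (Function.support fun p => (fibreMult f q p : ℝ)).Finite :=
  Set.Finite.of_option (finite_support_rootMultiplicity (fibrePoly_ne_zero hf q))

theorem finite_support_ramificationMult (hf : ¬ ∃ c, f = RatFunc.C c) :
    (Function.support fun p => (ramificationMult f p : ℝ)).Finite :=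
  Set.Finite.of_option (finite_support_rootMultiplicity (wronskian_num_denom_ne_zero hf))

/-- All fibres have the same number of points, counted with multiplicities. -/
theorem finsum_fibreMult (hf : ¬ ∃ c, f = RatFunc.C c) (q : OnePoint ℂ) :
    ∑ᶠ p, (fibreMult f q p : ℝ) = ratDegree f := by
  refine (finsum_option (f := fun p => (fibreMult f q p : ℝ))
    (finite_support_rootMultiplicity (fibrePoly_ne_zero hf q))).trans ?_
  have h : ∑ᶠ p : ℂ, (fibreMult f q (some p) : ℝ) = (fibrePoly f q).natDegree :=
    finsum_rootMultiplicity (fibrePoly_ne_zero hf q)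
  rw [h]
  change ((ratDegree f - (fibrePoly f q).natDegree : ℕ) : ℝ) + _ = _
  rw [Nat.cast_sub (natDegree_fibrePoly_le f q), sub_add_cancel]

/-- The Riemann-Hurwitz formula for rational functions. -/
theorem finsum_ramificationMult (hf : ¬ ∃ c, f = RatFunc.C c) :
    ∑ᶠ p, (ramificationMult f p : ℝ) = 2 * ratDegree f - 2 := by
  refine (finsum_option (f := fun p => (ramificationMult f p : ℝ))
    (finite_support_rootMultiplicity (wronskian_num_denom_ne_zero hf))).trans ?_
  have h : ∑ᶠ p : ℂ, (ramificationMult f (some p) : ℝ) = (wronskian f.num f.denom).natDegree :=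
    finsum_rootMultiplicity (wronskian_num_denom_ne_zero hf)
  rw [h]
  obtain ⟨q, h1, -, h3⟩ := exists_hasRamification_infty hf
  have : fibreMult f q OnePoint.infty ≠ 0 := by
    cases q with
    | coe q => exact h1.1
    | infty => exact h1.1
  have hR : (2 * ratDegree f - 2 - (wronskian f.num f.denom).natDegree) +
      (wronskian f.num f.denom).natDegree + 2 = 2 * ratDegree f := by omega
  change ((2 * ratDegree f - 2 - (wronskian f.num f.denom).natDegree : ℕ) : ℝ) + _ = _
  rw [eq_sub_iff_add_eq]
  exact_mod_cast hR

end Fibre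

/-! ### The formula for pullbacks of hypergeometric operators -/

namespace DiffOp

/-- The contribution of a point `p` to the degree formula: minus its multiplicity in the
ramification divisor, plus a term for each of the fibres over `0`, `1` and `∞`. -/
theorem one_sub_expDiff_pullback_gauss {a₁ a₂ b₁ : ℂ} {f r : RatFunc ℂ} {M L : DiffOp}
    (hf : ¬ ∃ c : ℂ, f = RatFunc.C c) (hM : ChangeOfVariables f (gauss a₁ a₂ b₁) M)
    (hL : ExpProduct r M L) {p : OnePoint ℂ} (hp : RegularSingularAt L p) :
    1 - expDiff L p = -(ramificationMult f p : ℝ) +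
      ((fibreMult f ((0 : ℂ) : OnePoint ℂ) p : ℝ) *
          (1 - expDiff (gauss a₁ a₂ b₁) ((0 : ℂ) : OnePoint ℂ)) +
        (fibreMult f ((1 : ℂ) : OnePoint ℂ) p : ℝ) *
          (1 - expDiff (gauss a₁ a₂ b₁) ((1 : ℂ) : OnePoint ℂ)) +
        (fibreMult f OnePoint.infty p : ℝ) *
          (1 - expDiff (gauss a₁ a₂ b₁) OnePoint.infty)) := by
  obtain ⟨q, hq, hne, hR⟩ := exists_hasRamification hf p
  rw [expDiff_pullback (hasMonicCoeffs_gauss a₁ a₂ b₁) hf hM hL (regularSingular_gauss a₁ a₂ b₁ q)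
    hp hq]
  have hR' : (ramificationMult f p : ℝ) = fibreMult f q p - 1 := by
    rw [hR]
    push_cast
    ring
  rw [hR']
  cases q with
  | infty =>
    rw [hne _ (OnePoint.coe_ne_infty 0), hne _ (OnePoint.coe_ne_infty 1)]
    push_cast
    ring
  | coe q =>
    rw [hne _ (OnePoint.infty_ne_coe q)]
    by_cases h0 : q = 0
    · subst h0
      rw [hne ((1 : ℂ) : OnePoint ℂ) (by simp)]
      push_cast
      ring
    by_cases h1 : q = 1
    · subst h1
      rw [hne ((0 : ℂ) : OnePoint ℂ) (by simp)]
      push_cast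
      ring
    rw [hne ((0 : ℂ) : OnePoint ℂ) (by simpa using Ne.symm h0),
      hne ((1 : ℂ) : OnePoint ℂ) (by simpa using Ne.symm h1),
      (expDiff_gauss_coe a₁ a₂ b₁ h0 h1).2]
    push_cast
    ring

theorem finsum_one_sub_expDiff_pullback_gauss {a₁ a₂ b₁ : ℂ} {f r : RatFunc ℂ} {M L : DiffOp}
    (hf : ¬ ∃ c : ℂ, f = RatFunc.C c) (hM : ChangeOfVariables f (gauss a₁ a₂ b₁) M)
    (hL : ExpProduct r M L) (hreg : RegularSingular L) :
    {p : OnePoint ℂ | 1 - expDiff L p ≠ 0}.Finite ∧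
      -2 + ∑ᶠ p : OnePoint ℂ, (1 - expDiff L p) =
        (ratDegree f : ℝ) * (-2 + ((1 - expDiff (gauss a₁ a₂ b₁) ((0 : ℂ) : OnePoint ℂ)) +
          (1 - expDiff (gauss a₁ a₂ b₁) ((1 : ℂ) : OnePoint ℂ)) +
          (1 - expDiff (gauss a₁ a₂ b₁) OnePoint.infty))) := by
  have hE : (fun p => 1 - expDiff L p) = _ :=
    funext fun p => one_sub_expDiff_pullback_gauss hf hM hL (hreg p)
  have hR : (Function.support fun p => -(ramificationMult f p : ℝ)).Finite := by
    rw [Function.support_fun_neg]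
    exact finite_support_ramificationMult hf
  have hF (q : OnePoint ℂ) (x : ℝ) :
      (Function.support fun p => (fibreMult f q p : ℝ) * x).Finite :=
    (finite_support_fibreMult hf q).subset (Function.support_mul_subset_left _ _)
  have hF01 := fun x y => ((hF ((0 : ℂ) : OnePoint ℂ) x).union (hF ((1 : ℂ) : OnePoint ℂ) y)).subset
    (Function.support_add _ _)
  have hF01i := fun x y z => ((hF01 x y).union (hF OnePoint.infty z)).subset
    (Function.support_add _ _)
  refine ⟨?_, ?_⟩
  · change (Function.support fun p => 1 - expDiff L p).Finite
    rw [hE]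
    exact (hR.union (hF01i _ _ _)).subset (Function.support_add _ _)
  · rw [hE, finsum_add_distrib hR (hF01i _ _ _), finsum_add_distrib (hF01 _ _) (hF _ _),
      finsum_add_distrib (hF _ _) (hF _ _), finsum_neg_distrib, finsum_ramificationMult hf,
      ← finsum_mul, ← finsum_mul, ← finsum_mul, finsum_fibreMult hf, finsum_fibreMult hf,
      finsum_fibreMult hf]
    ring

end DiffOp

end

/-- The Riemann-Hurwitz type formula for a pullback of a Gauss hypergeometric operator, and the
invariance of exponent differences under exp-products. -/
theorem mainTheorem3 :
    (∀ (a₁ a₂ b₁ : ℂ) (f r : RatFunc ℂ) (M L : DiffOp),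
      (¬ ∃ c : ℂ, f = RatFunc.C c) →
      DiffOp.ChangeOfVariables f (DiffOp.gauss a₁ a₂ b₁) M →
      DiffOp.ExpProduct r M L →
      DiffOp.RegularSingular L →
      ∀ α₀ α₁ αinf : ℝ,
        α₀ = DiffOp.expDiff (DiffOp.gauss a₁ a₂ b₁) ((0 : ℂ) : OnePoint ℂ) →
        α₁ = DiffOp.expDiff (DiffOp.gauss a₁ a₂ b₁) ((1 : ℂ) : OnePoint ℂ) →
        αinf = DiffOp.expDiff (DiffOp.gauss a₁ a₂ b₁) OnePoint.infty →
        (α₀ = ‖1 - b₁‖ ∧ α₁ = ‖b₁ - a₁ - a₂‖ ∧ αinf = ‖a₁ - a₂‖) ∧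
        {p : OnePoint ℂ | 1 - DiffOp.expDiff L p ≠ 0}.Finite ∧
        -2 + ∑ᶠ p : OnePoint ℂ, (1 - DiffOp.expDiff L p) =
          (ratDegree f : ℝ) * (-2 + ((1 - α₀) + (1 - α₁) + (1 - αinf)))) ∧
    (∀ (L₁ L₂ : DiffOp) (r : RatFunc ℂ) (p : OnePoint ℂ),
      L₁.natDegree = 2 →
      DiffOp.ExpProduct r L₁ L₂ →
      DiffOp.RegularSingularAt L₁ p →
      DiffOp.RegularSingularAt L₂ p →
      DiffOp.expDiff L₂ p = DiffOp.expDiff L₁ p) := by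
  refine ⟨?_, fun L₁ L₂ r p hL h h₁ h₂ => DiffOp.expDiff_eq_of_expProduct hL h h₁ h₂⟩
  rintro a₁ a₂ b₁ f r M L hf hM hL hreg α₀ α₁ αinf rfl rfl rfl
  exact ⟨⟨(DiffOp.expDiff_gauss_zero a₁ a₂ b₁).2, (DiffOp.expDiff_gauss_one a₁ a₂ b₁).2,
    (DiffOp.expDiff_gauss_infty a₁ a₂ b₁).2⟩,
    DiffOp.finsum_one_sub_expDiff_pullback_gauss hf hM hL hreg⟩
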